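/- **S-brane solution governed by the $HA_2^{(1)}$ Toda chain.** Let $t=x^0$, $J\subset\mathbb R$ an open interval, and consider $J\times\mathbb R^{10}$ with coordinates $(t,x^1,\dots,x^{10})$. The $B_{11}$-model has the action $\int d^{11}z\,\sqrt{|g|}\,\{R[g]-\frac1{4!}(F)^2\}$, where $g$ has signature $(-,+,\dots,+)$ and $F=dA$ is a 4-form. Its field equations are $R_{MN}-\frac12Rg_{MN}=\frac1{4!}\bigl(4F_{MPQR}F_N{}^{PQR}-\frac12 g_{MN}F^2\bigr)$ and $\partial_M(\sqrt{|g|}F^{MNPQ})=0$. Bosonic $D=11$ supergravity has in addition a Chern–Simons term; in this normalization of $F$ its field equations are the same Einstein equations together with $d{*F}=\pm\frac1{\sqrt2}F\wedge F$ (the sign depends on the orientation). Consider four electric $SM2$-branes with brane sets $I_1=\{1,2,3\}$, $I_2=\{4,5,6\}$, $I_3=\{7,8,9\}$, $I_4=\{1,4,10\}$, and the matrix $$A=\begin{pmatrix}2&-1&-1&0\\-1&2&-1&0\\-1&-1&2&-1\\0&0&-1&2\end{pmatrix}.$$ For $U^s=(U^s_i)$ with $U^s_i=1$ if $i\in I_s$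 and $U^s_i=0$ otherwise ($i=1,\dots,10$), let $(U^s,U^{s'})=\sum_{i,j}G^{ij}U^s_iU^{s'}_j$, where $(G^{ij})$ is the inverse of the matrix $G_{ij}=\delta_{ij}-1$. **(a)** $A$ is the Cartan matrix of the hyperbolic Kac–Moody algebra $HA_2^{(1)}$: it is a symmetric generalized Cartan matrix of signature $(-,+,+,+)$, and removing any node from its Dynkin diagram leaves a diagram all of whose components are of finite or affine type. The brane sets obey the corresponding intersection rules: $(U^s,U^s)=2$ and $A_{ss'}=2(U^s,U^{s'})/(U^{s'},U^{s'})$ for all $s,s'$, and $|I_s\cap I_{s'}|=\frac{|I_s||I_{s'}|}{9}+A_{ss'}$ for $s\ne s'$. **(b)** Let $Q_s\neq0$ ($s=1,\dots,4$), let $q^s$ be functions on $J$ satisfying the Toda equations $$\ddot q^s=-2Q_s^2\exp\Bigl(\sum_{s'=1}^4A_{ss'}q^{s'}\Bigr),\qquad s=1,\dots,4,$$ and put $f_s=\exp(-q^s(t))$. Then $$E_T=\frac18\sum_{s,s'=1}^4A_{ss'}\dot q^s\dot q^{s'}+\frac12\sum_{s=1}^4Q_s^2\exp\Bigl(\sum_{s'=1}^4A_{ss'}q^{s'}\Bigr)$$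 is constant on $J$. Let $c^0,\dots,c^{10}$ and $\bar c^0,\dots,\bar c^{10}$ be real constants with $c^0=\sum_{j=1}^{10}c^j$, $\bar c^0=\sum_{j=1}^{10}\bar c^j$, such that $\sum_{i\in I_s}c^i=\sum_{i\in I_s}\bar c^i=0$ for $s=1,\dots,4$ and $$2E_T+\sum_{i=1}^{10}(c^i)^2-\Bigl(\sum_{i=1}^{10}c^i\Bigr)^2=0.$$ Then the smooth metric of signature $(-,+,\dots,+)$ $$g=(f_1f_2f_3f_4)^{1/3}\Bigl\{-e^{2c^0t+2\bar c^0}dt\otimes dt+\sum_{i=1}^{10}\Bigl(\prod_{s:\,i\in I_s}f_s\Bigr)^{-1}e^{2c^it+2\bar c^i}dx^i\otimes dx^i\Bigr\}$$ and the smooth 4-form $$F=Q_1f_1^{-2}f_2f_3\,dt\wedge dx^1\wedge dx^2\wedge dx^3+Q_2f_1f_2^{-2}f_3\,dt\wedge dx^4\wedge dx^5\wedge dx^6$$ $$\quad+Q_3f_1f_2f_3^{-2}f_4\,dt\wedge dx^7\wedge dx^8\wedge dx^9+Q_4f_3f_4^{-2}\,dt\wedge dx^1\wedge dx^4\wedge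 dx^{10}$$ solve the field equations of the $B_{11}$-model on $J\times\mathbb R^{10}$ (in particular $F=dA$ for a smooth 3-form $A$). Moreover $F\wedge F=0$, and $(g,F)$ also solves the field equations of bosonic $D=11$ supergravity. **(c)** (Special one-block solution.) One has $b_s:=2\sum_{s'=1}^4(A^{-1})_{ss'}=-12,-12,-14,-6$ for $s=1,2,3,4$. Let $Q\ne0$, $C,t_0\in\mathbb R$, let $Q_s^2=Q^2|b_s|$, and let $$\bar f(t)=\begin{cases}|Q|\sqrt{2/C}\,\sinh(\sqrt C(t-t_0)),&C>0,\\|Q|\sqrt{2/|C|}\,\sin(\sqrt{|C|}(t-t_0)),&C<0,\\|Q|\sqrt2\,(t-t_0),&C=0.\end{cases}$$ On any open interval $J$ on which $\bar f$ has no zero, $f_s=\bar f^{\,b_s}$ is positive, the functions $q^s=-\ln f_s$ solve the Toda equations of (b), and $E_T=-11C$. Hence, for all $c,\bar c$ satisfying the constraints of (b) with $E_T=-11C$, the pair $(g,F)$ of (b) with these $f_s$ solves the $B_{11}$-model and bosonic $D=11$ supergravity. -/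

import Mathlib

open scoped ContDiff

noncomputable section

namespace SBrane

/-! ## Lorentzian geometry in global coordinates on an open subset of `ℝ¹¹` -/

/-- Coordinate space: coordinate `0` is the time `t`, coordinates `1, …, 10` are `x¹, …, x¹⁰`. -/
abbrev Pt : Type := Fin 11 → ℝ

/-- The coordinate vector `∂ / ∂xᴹ`. -/
def basisVec (M : Fin 11) : Pt := Pi.single M 1

/-- The partial derivative `∂_M f`. -/
def pd (M : Fin 11) (f : Pt → ℝ) (x : Pt) : ℝ := fderiv ℝ f x (basisVec M)

/-- A real square matrix represents a symmetric bilinear form of signature `(-, +, …, +)`. -/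
def HasLorentzSignature {n : ℕ} (g : Matrix (Fin (n + 1)) (Fin (n + 1)) ℝ) : Prop :=
  ∃ P : Matrix (Fin (n + 1)) (Fin (n + 1)) ℝ, IsUnit P.det ∧
    P.transpose * g * P = Matrix.diagonal (Fin.cons (-1) (fun _ => 1))

/-- A field of matrices `g_{MN}(x)`. -/
abbrev MetricField : Type := Pt → Matrix (Fin 11) (Fin 11) ℝ

/-- The Christoffel symbol `Γᴷ_{MN}` of the Levi-Civita connection. -/
def christoffel (g : MetricField) (K M N : Fin 11) (x : Pt) : ℝ :=
  (1 / 2) * ∑ L, (g x)⁻¹ K L *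
    (pd M (fun y => g y L N) x + pd N (fun y => g y L M) x - pd L (fun y => g y M N) x)

/-- The Ricci tensor `R_{MN}[g]` (positive for round spheres). -/
def ricci (g : MetricField) (x : Pt) (M N : Fin 11) : ℝ :=
  ∑ K, (pd K (christoffel g K M N) x - pd N (christoffel g K M K) x
    + ∑ L, (christoffel g K K L x * christoffel g L M N x
      - christoffel g K N L x * christoffel g L M K x))

/-- The scalar curvature `R[g]`. -/
def scalarCurvature (g : MetricField) (x : Pt) : ℝ :=
  ∑ M, ∑ N, (g x)⁻¹ M N * ricci g x M N

/-! ## Differential forms -/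

/-- A differential `k`-form. -/
abbrev FormField (k : ℕ) : Type := Pt → Pt [⋀^Fin k]→L[ℝ] ℝ

/-- The constant form `dx^{a₀} ∧ ⋯ ∧ dx^{aₖ₋₁}`, that is `(v₀, …, vₖ₋₁) ↦ det (vᵢ^{aⱼ})`. -/
def coordForm {k : ℕ} (a : Fin k → Fin 11) : Pt [⋀^Fin k]→L[ℝ] ℝ where
  toMultilinearMap :=
    (Matrix.detRowAlternating.compLinearMap (LinearMap.funLeft ℝ ℝ a)).toMultilinearMap
  cont := by
    change Continuous fun v : Fin k → Pt => Matrix.det (fun i j => v i (a j))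
    exact Continuous.matrix_det (by fun_prop)
  map_eq_zero_of_eq' :=
    (Matrix.detRowAlternating.compLinearMap (LinearMap.funLeft ℝ ℝ a)).map_eq_zero_of_eq'

theorem coordForm_apply {k : ℕ} (a : Fin k → Fin 11) (v : Fin k → Pt) :
    coordForm a v = Matrix.det (Matrix.of fun i j => v i (a j)) := rfl

/-- The component `F_{I₀ … Iₖ₋₁}`. -/
def comp {k : ℕ} (F : FormField k) (x : Pt) (I : Fin k → Fin 11) : ℝ :=
  F x (fun j => basisVec (I j))

/-- The contravariant component `F^{I₀ … Iₖ₋₁}`. -/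
def raised {k : ℕ} (g : MetricField) (F : FormField k) (x : Pt) (I : Fin k → Fin 11) : ℝ :=
  ∑ J : Fin k → Fin 11, (∏ j, (g x)⁻¹ (I j) (J j)) * comp F x J

/-- The contraction `F_{I₀ … Iₖ₋₁} F^{I₀ … Iₖ₋₁}`. -/
def normSq {k : ℕ} (g : MetricField) (F : FormField k) (x : Pt) : ℝ :=
  ∑ I : Fin k → Fin 11, comp F x I * raised g F x I

/-- The contraction `F_{M P Q R} F_N^{P Q R}`. -/
def contractPair (g : MetricField) (F : FormField 4) (x : Pt) (M N : Fin 11) : ℝ :=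
  ∑ K : Fin 3 → Fin 11, ∑ L : Fin 3 → Fin 11,
    (∏ j, (g x)⁻¹ (K j) (L j)) * (comp F x (Fin.cons M K) * comp F x (Fin.cons N L))

/-- The 8-form `F ∧ F`. -/
def wedgeSelf (F : FormField 4) (x : Pt) (v : Fin 8 → Pt) : ℝ :=
  (1 / ((Nat.factorial 4 : ℝ) * Nat.factorial 4)) *
    ∑ σ : Equiv.Perm (Fin 8), ((Equiv.Perm.sign σ : ℤ) : ℝ) *
      (F x ![v (σ 0), v (σ 1), v (σ 2), v (σ 3)] * F x ![v (σ 4), v (σ 5), v (σ 6), v (σ 7)])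

/-- The Levi-Civita symbol of `ℝ¹¹`: the sign of `L` if `L` is a permutation, and `0` otherwise. -/
def leviCivita (L : Fin 11 → Fin 11) : ℝ :=
  Matrix.det (Matrix.of fun i j => if L i = j then (1 : ℝ) else 0)

/-! ## The field equations -/

/-- `(g, F)` is a solution on the region `U` of the field equations of eleven-dimensional gravity
coupled to a 4-form `F = dA` through the Lagrangian `√|g| (R[g] - F² / 4!)` together with a
Chern-Simons term `A ∧ F ∧ F`, the latter being normalised so that the form equation is
`d * F = ± k F ∧ F`, i.e.
`∂_M (√|g| F^{MNPQ}) = (k / 8!) ε^{N P Q K₁ … K₈} (F ∧ F)_{K₁ … K₈}`. -/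
structure SolvesFieldEquations (k : ℝ) (U : Set Pt) (g : MetricField) (F : FormField 4) :
    Prop where
  smooth_metric : ∀ M N, ContDiffOn ℝ ∞ (fun x => g x M N) U
  lorentzian : ∀ x ∈ U, HasLorentzSignature (n := 10) (g x)
  smooth_form : ContDiffOn ℝ ∞ F U
  exists_potential : ∃ A : FormField 3, ContDiffOn ℝ ∞ A U ∧ ∀ x ∈ U, extDeriv A x = F x
  einstein : ∀ x ∈ U, ∀ M N,
    ricci g x M N - (1 / 2) * scalarCurvature g x * g x M N =
      (1 / (Nat.factorial 4 : ℝ)) *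
        (4 * contractPair g F x M N - (1 / 2) * g x M N * normSq g F x)
  form_equation : ∀ x ∈ U, ∀ N P Q,
    ∑ M, pd M (fun y => √|(g y).det| * raised g F y ![M, N, P, Q]) x =
      (k / Nat.factorial 8) * ∑ K : Fin 8 → Fin 11,
        leviCivita (Fin.append ![N, P, Q] K) * wedgeSelf F x (fun j => basisVec (K j))

/-- Solutions of the `B₁₁`-model, with action `∫ √|g| (R[g] - F² / 4!)`. -/
abbrev SolvesB11 (U : Set Pt) (g : MetricField) (F : FormField 4) : Prop :=
  SolvesFieldEquations 0 U g F

/-- Bosonic solutions of `D = 11` supergravity. With the kinetic term `-F² / 4!` the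
Chern-Simons coupling is `1 / √2` up to a sign `σ`, which depends on the orientation. (For the
rescaled form `√2 F`, with kinetic term `-F² / (2 · 4!)`, this is the usual
`d * F = ± (1 / 2) F ∧ F`.) -/
abbrev SolvesSupergravity (σ : ℤˣ) (U : Set Pt) (g : MetricField) (F : FormField 4) : Prop :=
  SolvesFieldEquations (((σ : ℤ) : ℝ) / √2) U g F

/-! ## Branes and intersection rules -/

/-- The Cartan matrix of `HA₂⁽¹⁾`. -/
def cartan : Matrix (Fin 4) (Fin 4) ℤ :=
  !![ 2, -1, -1,  0;
     -1,  2, -1,  0;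
     -1, -1,  2, -1;
      0,  0, -1,  2]

/-- The Cartan matrix as a real matrix. -/
def cartanR : Matrix (Fin 4) (Fin 4) ℝ := cartan.map (Int.cast : ℤ → ℝ)

/-- A symmetric generalized Cartan matrix of hyperbolic type: its signature is `(-, +, …, +)`, and
removing any node from its Dynkin diagram leaves a diagram all of whose components are of finite or
affine type (for a symmetric generalized Cartan matrix: a positive semidefinite matrix). -/
structure IsHyperbolicCartan {n : ℕ} (A : Matrix (Fin (n + 1)) (Fin (n + 1)) ℤ) : Prop where
  diag : ∀ i, A i i = 2
  off_diag : ∀ i j, i ≠ j → A i j ≤ 0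
  symm : A.IsSymm
  lorentzian : HasLorentzSignature (A.map (Int.cast : ℤ → ℝ))
  remove_node : ∀ i : Fin (n + 1),
    ((A.map (Int.cast : ℤ → ℝ)).submatrix i.succAbove i.succAbove).PosSemidef

/-- The brane sets `I₁ = {1,2,3}`, `I₂ = {4,5,6}`, `I₃ = {7,8,9}`, `I₄ = {1,4,10}`. -/
def braneSet : Fin 4 → Finset (Fin 11) :=
  ![{1, 2, 3}, {4, 5, 6}, {7, 8, 9}, {1, 4, 10}]

/-- The minisuperspace metric `G_{ij} = δ_{ij} - 1` for ten one-dimensional factor spaces; the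
index `i : Fin 10` stands for the coordinate `i.succ`. -/
def miniMetric : Matrix (Fin 10) (Fin 10) ℝ :=
  Matrix.of fun i j => (if i = j then 1 else 0) - 1

/-- The brane co-vector `U^s`: `U^s_i = 1` if `i ∈ I_s`, and `0` otherwise. -/
def braneVec (s : Fin 4) : Fin 10 → ℝ := fun i => if i.succ ∈ braneSet s then 1 else 0

/-- The scalar product `(U, V) = G^{ij} U_i V_j`, where `(G^{ij})` is the inverse of `(G_{ij})`. -/
def scalarProd (u v : Fin 10 → ℝ) : ℝ := ∑ i, ∑ j, miniMetric⁻¹ i j * u i * v j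

/-! ## Toda chain -/

/-- The potential term `exp (∑_{s'} A_{s s'} q^{s'})`. -/
def todaExp (q : Fin 4 → ℝ → ℝ) (s : Fin 4) (t : ℝ) : ℝ :=
  Real.exp (∑ s', cartanR s s' * q s' t)

/-- `q` solves `q̈^s = - 2 Q_s² exp (∑_{s'} A_{s s'} q^{s'})` on `J`. -/
def IsTodaSolution (Q : Fin 4 → ℝ) (J : Set ℝ) (q : Fin 4 → ℝ → ℝ) : Prop :=
  ∀ s, ∀ t ∈ J, DifferentiableAt ℝ (q s) t ∧
    HasDerivAt (deriv (q s)) (-2 * Q s ^ 2 * todaExp q s t) t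

/-- `E_T = (1/8) ∑ A_{s s'} q̇^s q̇^{s'} + (1/2) ∑ Q_s² exp (∑_{s'} A_{s s'} q^{s'})`. -/
def todaEnergy (Q : Fin 4 → ℝ) (q : Fin 4 → ℝ → ℝ) (t : ℝ) : ℝ :=
  (1 / 8) * ∑ s, ∑ s', cartanR s s' * deriv (q s) t * deriv (q s') t
    + (1 / 2) * ∑ s, Q s ^ 2 * todaExp q s t

/-! ## The S-brane configuration -/

/-- The parameters `c⁰, c¹, …, c¹⁰` satisfy `c⁰ = ∑_{j=1}^{10} c^j` and the brane constraints
`U^s(c) = ∑_{i ∈ I_s} c^i = 0`. -/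
def BraneConstraints (c : Fin 11 → ℝ) : Prop :=
  c 0 = ∑ j : Fin 10, c j.succ ∧ ∀ s, ∑ i ∈ braneSet s, c i = 0

/-- The constraint `2 E + ∑_{i=1}^{10} (c^i)² - (∑_{i=1}^{10} c^i)² = 0`. -/
def EnergyConstraint (E : ℝ) (c : Fin 11 → ℝ) : Prop :=
  2 * E + ∑ i : Fin 10, c i.succ ^ 2 - (∑ i : Fin 10, c i.succ) ^ 2 = 0

/-- The metric `g = (f₁ f₂ f₃ f₄)^{1/3} { - e^{2 c⁰ t + 2 c̄⁰} dt ⊗ dt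
+ ∑_{i=1}^{10} (∏_{s : i ∈ I_s} f_s)⁻¹ e^{2 c^i t + 2 c̄^i} dx^i ⊗ dx^i }`. -/
def braneMetric (f : Fin 4 → ℝ → ℝ) (c cbar : Fin 11 → ℝ) : MetricField := fun x =>
  Matrix.diagonal fun M =>
    (∏ s, f s (x 0)) ^ (1 / 3 : ℝ) *
      ((if M = 0 then -1 else (∏ s with M ∈ braneSet s, f s (x 0))⁻¹) *
        Real.exp (2 * c M * x 0 + 2 * cbar M))

/-- The indices of the forms `dt ∧ τ(I_s)`. -/
def braneIndex : Fin 4 → Fin 4 → Fin 11 :=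
  ![![0, 1, 2, 3], ![0, 4, 5, 6], ![0, 7, 8, 9], ![0, 1, 4, 10]]

/-- The 4-form `F = ∑_s Q_s (∏_{s'} f_{s'}^{-A_{s s'}}) dt ∧ τ(I_s)`. -/
def braneForm (Q : Fin 4 → ℝ) (f : Fin 4 → ℝ → ℝ) : FormField 4 := fun x =>
  ∑ s, (Q s * ∏ s', f s' (x 0) ^ (-cartan s s')) • coordForm (braneIndex s)

/-- The region `J × ℝ¹⁰`. -/
def region (J : Set ℝ) : Set Pt := {x | x 0 ∈ J}

/-! ## The special one-block solution -/

/-- The integers `b_s`. -/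
def bCoeff : Fin 4 → ℤ := ![-12, -12, -14, -6]

/-- The function `f̄` with parameters `Q`, `C`, `t₀`. -/
def fBar (Q C t₀ : ℝ) (t : ℝ) : ℝ :=
  if 0 < C then |Q| * √(2 / C) * Real.sinh (√C * (t - t₀))
  else if C < 0 then |Q| * √(2 / |C|) * Real.sin (√|C| * (t - t₀))
  else |Q| * √2 * (t - t₀)

end SBrane

end

namespace SBrane

open Filter Topology

/-! Write the metric as diagonal with entries `±exp (2 φ^M(t))`, where `φ^M` (`logScale`) is linear
in the `q^s` plus `c^M t + c̄^M`. Two facts about the exponents drive everything.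

Harmonic gauge (`sum_braneInd_harmonic`): the sum of all `φ^M` is `2 φ⁰`. It removes the
first-derivative terms from the spatial Ricci components, leaving only second derivatives of `φ^M`,
which the Toda equations turn into the exponentials `todaExp`. It also gives `√|g| = -g₀₀`.

Intersection rules (`sum_logScale_braneSet`): because `|I_s ∩ I_{s'}| = 1 + A_{ss'}`, the product of
the metric entries over `I_s` is exactly `todaExp q s`. Hence `√|g| F^{MNPQ}` is constant, and the
quadratic contractions of `F` are sums of `Q_s² todaExp`. Distinct branes overlap in at most one
direction, so these contractions are diagonal.

The spatial Einstein equations then match term by term; the `00` component also needs the energy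
constraint (`sum_logScaleDeriv_sq`). The form `F` is exact because its coefficients are multiples of
second derivatives of the `q^s`, and `F ∧ F = 0` because every term contains `dt`, so the
Chern–Simons coupling is irrelevant. The one-block solution reduces to `f̄'' = C f̄` with first
integral `f̄'² - C f̄² = 2Q²`, together with `A b = (2,2,2,2)`. -/

/-! ### The Cartan matrix and the intersection rules -/

theorem cartan_posSemidef_submatrix (i : Fin 4) :
    ((cartan.map (Int.cast : ℤ → ℝ)).submatrix i.succAbove i.succAbove).PosSemidef := by
  refine Matrix.PosSemidef.of_dotProduct_mulVec_nonneg ?_ fun x => ?_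
  · ext a b
    fin_cases i <;> fin_cases a <;> fin_cases b <;> simp [cartan, Fin.succAbove]
  -- Deleting the first or second node leaves `A₃`, the third `A₂ ⊔ A₁`, the fourth affine `A₂⁽¹⁾`;
  -- in each case the quadratic form is a sum of squares.
  · fin_cases i <;>
      simp [cartan, Fin.succAbove, Matrix.mulVec, dotProduct, Fin.sum_univ_succ]
    · nlinarith [sq_nonneg (x 0 - x 1), sq_nonneg (x 1 - x 2), sq_nonneg (x 0), sq_nonneg (x 2)]
    · nlinarith [sq_nonneg (x 0 - x 1), sq_nonneg (x 1 - x 2), sq_nonneg (x 0), sq_nonneg (x 2)]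
    · nlinarith [sq_nonneg (x 0 - x 1), sq_nonneg (x 1 - x 2), sq_nonneg (x 0), sq_nonneg (x 2),
        sq_nonneg (x 1)]
    · nlinarith [sq_nonneg (x 0 - x 1), sq_nonneg (x 1 - x 2), sq_nonneg (x 0 - x 2)]

theorem cartan_hasLorentzSignature :
    HasLorentzSignature (n := 3) (cartan.map (Int.cast : ℤ → ℝ)) := by
  have h2 : (√2)⁻¹ * (√2)⁻¹ = (1 / 2 : ℝ) := by
    rw [← mul_inv, Real.mul_self_sqrt (by norm_num)]; norm_num
  have h6 : (√6)⁻¹ * (√6)⁻¹ = (1 / 6 : ℝ) := by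
    rw [← mul_inv, Real.mul_self_sqrt (by norm_num)]; norm_num
  generalize (√2)⁻¹ = a at *
  generalize (√6)⁻¹ = b at *
  -- The vector `v = (2,2,2,1)` has `A v = (0,0,-1,0)` and norm `-2`, so it is timelike and
  -- orthogonal to everything with vanishing third entry. There, `(1,0,0,0)`, `(1,2,0,0)`,
  -- `(0,0,0,1)` are orthogonal of norms `2, 6, 2`.
  have key : (!![2 * a, a, b, 0; 2 * a, 0, 2 * b, 0; 2 * a, 0, 0, 0; a, 0, 0, a] :
      Matrix (Fin 4) (Fin 4) ℝ).transpose * cartan.map (Int.cast : ℤ → ℝ) *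
      !![2 * a, a, b, 0; 2 * a, 0, 2 * b, 0; 2 * a, 0, 0, 0; a, 0, 0, a] =
      Matrix.diagonal (Fin.cons (-1) (fun _ => 1)) := by
    have hd : Matrix.diagonal (Fin.cons (-1) (fun _ => 1)) =
        (!![-1, 0, 0, 0; 0, 1, 0, 0; 0, 0, 1, 0; 0, 0, 0, 1] : Matrix (Fin 4) (Fin 4) ℝ) := by
      ext i j
      fin_cases i <;> fin_cases j <;> rfl
    rw [hd]
    ext i j
    fin_cases i <;> fin_cases j <;>
      simp [cartan, Matrix.mul_apply, Fin.sum_univ_succ, -mul_eq_zero] <;> ring_nf at * <;>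
      linarith
  refine ⟨_, ?_, key⟩
  refine isUnit_iff_ne_zero.2 fun h => ?_
  have := congrArg Matrix.det key
  simp [Matrix.det_mul, h, Matrix.det_diagonal, Fin.prod_univ_succ] at this

theorem cartan_isHyperbolicCartan : IsHyperbolicCartan (n := 3) cartan where
  diag := by decide
  off_diag := by
    change ∀ i j : Fin 4, i ≠ j → cartan i j ≤ 0
    intro i j
    fin_cases i <;> fin_cases j <;> simp [cartan]
  symm := by ext i j; fin_cases i <;> fin_cases j <;> rfl
  lorentzian := cartan_hasLorentzSignature
  remove_node := cartan_posSemidef_submatrix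

/-- With `E` the all-ones matrix, `E² = 10 E`, hence `(1 - E)(1 - E/9) = 1`. -/
theorem miniMetric_inv :
    miniMetric⁻¹ = Matrix.of fun i j : Fin 10 => (if i = j then (1 : ℝ) else 0) - 1 / 9 := by
  refine Matrix.inv_eq_right_inv ?_
  ext i j
  simp [miniMetric, Matrix.mul_apply, sub_mul, mul_sub, Finset.sum_sub_distrib, Matrix.one_apply]
  ring

theorem scalarProd_eq (u v : Fin 10 → ℝ) :
    scalarProd u v = ∑ i, u i * v i - (∑ i, u i) * (∑ i, v i) / 9 := by
  simp only [scalarProd, miniMetric_inv, Matrix.of_apply, sub_mul, ite_mul, one_mul, zero_mul,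
    Finset.sum_sub_distrib, Finset.sum_ite_eq, Finset.mem_univ, if_true]
  rw [Finset.sum_mul_sum, Finset.sum_div]
  simp only [Finset.sum_div]
  congr 1
  exact Finset.sum_congr rfl fun i _ => Finset.sum_congr rfl fun j _ => by ring

/-- Three-element sets give `|I_s ∩ I_{s'}| - 3·3/9`, so only the intersection numbers matter. -/
theorem scalarProd_braneVec (s s' : Fin 4) :
    scalarProd (braneVec s) (braneVec s') = cartanR s s' := by
  rw [scalarProd_eq]
  simp only [braneVec, ← ite_and, mul_ite, mul_one, mul_zero, Finset.sum_boole, cartanR,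
    Matrix.map_apply]
  have h1 : ∀ s s' : Fin 4, (Finset.univ.filter fun i : Fin 10 =>
      i.succ ∈ braneSet s' ∧ i.succ ∈ braneSet s).card = cartan s s' + 1 := by decide
  have h2 : ∀ s : Fin 4, (Finset.univ.filter fun i : Fin 10 => i.succ ∈ braneSet s).card = 3 := by
    decide
  have := h1 s s'
  rw [h2, h2, show ((cartan s s' : ℤ) : ℝ) = ((cartan s s' + 1 : ℤ) : ℝ) - 1 by push_cast; ring,
    ← this]
  push_cast
  ring

theorem cartanR_diag (s : Fin 4) : cartanR s s = 2 := by
  fin_cases s <;> simp [cartanR, cartan]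

theorem card_braneSet (s : Fin 4) : (braneSet s).card = 3 := by
  revert s; decide

theorem card_braneSet_inter {s s' : Fin 4} :
    ((braneSet s ∩ braneSet s').card : ℝ) = 1 + cartanR s s' := by
  have : ∀ s s' : Fin 4, ((braneSet s ∩ braneSet s').card : ℤ) = 1 + cartan s s' := by decide
  have := this s s'
  simp only [cartanR, Matrix.map_apply]
  exact_mod_cast this

theorem cartanR_inv : cartanR⁻¹ =
    !![-4 / 3, -5 / 3, -2, -1; -5 / 3, -4 / 3, -2, -1; -2, -2, -2, -1; -1, -1, -1, 0] := by
  refine Matrix.inv_eq_right_inv ?_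
  ext i j
  fin_cases i <;> fin_cases j <;>
    simp [cartanR, cartan, Matrix.mul_apply, Fin.sum_univ_succ] <;> norm_num

theorem two_mul_sum_cartanR_inv (s : Fin 4) : 2 * ∑ s', cartanR⁻¹ s s' = (bCoeff s : ℝ) := by
  rw [cartanR_inv]
  fin_cases s <;> simp [bCoeff, Fin.sum_univ_succ] <;> norm_num

/-! ### Curvature of time-dependent diagonal metrics -/

theorem pd_congr {M : Fin 11} {f f' : Pt → ℝ} {x : Pt} (h : f =ᶠ[𝓝 x] f') :
    pd M f x = pd M f' x := by
  rw [pd, pd, h.fderiv_eq]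

theorem hasFDerivAt_time {f : ℝ → ℝ} {f' : ℝ} {x : Pt} (h : HasDerivAt f f' (x 0)) :
    HasFDerivAt (fun y : Pt => f (y 0))
      (f' • (ContinuousLinearMap.proj 0 : Pt →L[ℝ] ℝ)) x := by
  exact h.comp_hasFDerivAt x
    (ContinuousLinearMap.proj (R := ℝ) (φ := fun _ : Fin 11 => ℝ) 0).hasFDerivAt

theorem pd_time {f : ℝ → ℝ} {f' : ℝ} {x : Pt} (M : Fin 11) (h : HasDerivAt f f' (x 0)) :
    pd M (fun y => f (y 0)) x = if M = 0 then f' else 0 := by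
  rw [pd, (hasFDerivAt_time h).fderiv]
  simp [basisVec, Pi.single_apply, eq_comm]

theorem isOpen_region {J : Set ℝ} (hJ : IsOpen J) : IsOpen (region J) :=
  hJ.preimage (continuous_apply 0)

/-- The time-dependent diagonal metric with entries `h M (x 0)`. -/
def diagMetric (h : Fin 11 → ℝ → ℝ) : MetricField := fun x =>
  Matrix.diagonal fun M => h M (x 0)

theorem diagMetric_inv {h : Fin 11 → ℝ → ℝ} {x : Pt} (hx : ∀ M, h M (x 0) ≠ 0) :
    (diagMetric h x)⁻¹ = Matrix.diagonal fun M => (h M (x 0))⁻¹ := by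
  refine Matrix.inv_eq_right_inv ?_
  rw [diagMetric, Matrix.diagonal_mul_diagonal]
  simp [mul_inv_cancel₀ (hx _)]

/-- The Christoffel symbols of a time-dependent diagonal metric, where `a M` is half the
logarithmic derivative of the `M`-th entry and `r M` is `a M` times the ratio of the `M`-th
and the `0`-th entries. -/
def diagChristoffel (a r : Fin 11 → ℝ) (K M N : Fin 11) : ℝ :=
  (if M = 0 then if K = N then a K else 0 else 0)
    + (if N = 0 then if K = M then a K else 0 else 0)
    - (if K = 0 then if M = N then r M else 0 else 0)

theorem christoffel_diagMetric {h : Fin 11 → ℝ → ℝ} {a : Fin 11 → ℝ} {x : Pt}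
    (h0 : ∀ M, h M (x 0) ≠ 0) (hd : ∀ M, HasDerivAt (h M) (2 * a M * h M (x 0)) (x 0))
    (K M N : Fin 11) :
    christoffel (diagMetric h) K M N x =
      diagChristoffel a (fun M => a M * h M (x 0) / h 0 (x 0)) K M N := by
  have hpd : ∀ L A B, pd L (fun y => diagMetric h y A B) x =
      if L = 0 then if A = B then 2 * a A * h A (x 0) else 0 else 0 := by
    intro L A B
    by_cases hAB : A = B
    · subst hAB
      simp only [diagMetric, Matrix.diagonal_apply_eq, if_true]
      exact pd_time L (hd A)
    · simp [diagMetric, hAB, pd]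
  simp only [christoffel, diagMetric_inv h0, hpd, Matrix.diagonal_apply, ite_mul, zero_mul,
    Finset.sum_ite_eq, Finset.mem_univ, if_true, diagChristoffel]
  by_cases hM : M = 0 <;> by_cases hN : N = 0 <;> by_cases hK0 : K = 0 <;>
    by_cases hMN : M = N <;> by_cases hKN : K = N <;> by_cases hKM : K = M <;>
    simp_all <;> field_simp [h0]

/-- This trace is the logarithmic derivative of `√|g|`, which depends on time only. The hypothesis
`hr` reduces the three contributions to `Γ⁰₀₀` to a single `a 0`. -/
theorem sum_diagChristoffel_trace (a r : Fin 11 → ℝ) (hr : r 0 = a 0) (L : Fin 11) :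
    ∑ K, diagChristoffel a r K K L = if L = 0 then ∑ K, a K else 0 := by
  simp only [diagChristoffel, Finset.sum_add_distrib, Finset.sum_sub_distrib]
  by_cases hL : L = 0
  · subst hL; simp [hr]
  · simp [hL, Ne.symm hL]

theorem diagChristoffel_comm (a r : Fin 11 → ℝ) (K M N : Fin 11) :
    diagChristoffel a r K M N = diagChristoffel a r K N M := by
  simp only [diagChristoffel]
  by_cases h : M = N
  · subst h; ring
  · simp [h, Ne.symm h]; ring

theorem sum_diagChristoffel_trace' (a r : Fin 11 → ℝ) (hr : r 0 = a 0) (L : Fin 11) :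
    ∑ K, diagChristoffel a r K L K = if L = 0 then ∑ K, a K else 0 := by
  rw [← sum_diagChristoffel_trace a r hr]
  exact Finset.sum_congr rfl fun K _ => diagChristoffel_comm a r K L K

theorem sum_diagChristoffel_quadratic (a r : Fin 11 → ℝ) (hr : r 0 = a 0) (M N : Fin 11) :
    ∑ K, ∑ L, diagChristoffel a r K N L * diagChristoffel a r L M K =
      if M = N then if M = 0 then ∑ K, a K ^ 2 else -2 * a M * r M else 0 := by
  -- For `M = N = 0` only `K = L` survives; for `M = N ≠ 0` only the pairs `(M, 0)` and `(0, M)`.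
  -- The proof runs through all coincidence patterns of the indices.
  have key : ∀ K L, diagChristoffel a r K N L * diagChristoffel a r L M K =
      (if K = L then if M = 0 then if N = 0 then a K ^ 2 else 0 else 0 else 0)
      - (if M = N then if M = 0 then 0 else
          (if K = M then if L = 0 then a M * r M else 0 else 0)
          + (if K = 0 then if L = M then a M * r M else 0 else 0) else 0) := by
    intro K L
    simp only [diagChristoffel]
    by_cases hM : M = 0 <;> by_cases hN : N = 0 <;> by_cases hK0 : K = 0 <;>
      by_cases hL0 : L = 0 <;> by_cases hMN : M = N <;> by_cases hKN : K = N <;>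
      by_cases hKM : K = M <;> by_cases hLM : L = M <;> by_cases hLN : L = N <;>
      by_cases hKL : K = L <;>
      first
        | (exfalso; simp_all; done)
        | (simp_all [eq_comm]; done)
        | (simp_all [eq_comm]; ring)
  simp only [key, Finset.sum_sub_distrib, Finset.sum_ite_eq, Finset.mem_univ, if_true]
  by_cases hMN : M = N <;> by_cases hM : M = 0
  · subst hMN; simp [hM]
  · subst hMN; simp [hM, Finset.sum_add_distrib]; ring
  · subst hM; simp [hMN, Ne.symm hMN]
  · simp [hMN, hM]

/-- The Ricci tensor of a time-dependent diagonal metric. -/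
theorem ricci_diagMetric {h a : Fin 11 → ℝ → ℝ} {a' : Fin 11 → ℝ} {J : Set ℝ} (hJ : IsOpen J)
    (h0 : ∀ M, ∀ t ∈ J, h M t ≠ 0) (hd : ∀ M, ∀ t ∈ J, HasDerivAt (h M) (2 * a M t * h M t) t)
    {x : Pt} (hx : x ∈ region J) (ha : ∀ M, HasDerivAt (a M) (a' M) (x 0)) (M N : Fin 11) :
    ricci (diagMetric h) x M N =
      if M = N then
        if M = 0 then a' 0 - ∑ K, a' K + (a 0 (x 0)) * (∑ K, a K (x 0)) - ∑ K, a K (x 0) ^ 2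
        else -(h M (x 0) / h 0 (x 0)) *
          (a' M + a M (x 0) * (∑ K, a K (x 0) - 2 * a 0 (x 0)))
      else 0 := by
  have hev : ∀ᶠ y in 𝓝 x, y ∈ region J := (isOpen_region hJ).mem_nhds hx
  set r : Fin 11 → ℝ → ℝ := fun M t => a M t * h M t / h 0 t with hr
  have hc : ∀ y ∈ region J, ∀ K M N, christoffel (diagMetric h) K M N y =
      diagChristoffel (fun M => a M (y 0)) (fun M => r M (y 0)) K M N := fun y hy K M N =>
    christoffel_diagMetric (fun M => h0 M _ hy) (fun M => hd M _ hy) K M N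
  -- The derivative of `r M`: the ratio `h M / h 0` has logarithmic derivative `2 (a M - a 0)`.
  set r' : Fin 11 → ℝ := fun M =>
    (h M (x 0) / h 0 (x 0)) * (a' M + 2 * a M (x 0) * (a M (x 0) - a 0 (x 0))) with hr'
  have hz : h 0 (x 0) ≠ 0 := h0 0 _ hx
  have hrd : ∀ M, HasDerivAt (r M) (r' M) (x 0) := by
    intro M
    refine (((ha M).mul (hd M _ hx)).div (hd 0 _ hx) hz).congr_deriv ?_
    simp only [hr', Pi.mul_apply]
    field_simp
    ring
  have hr0 : r 0 (x 0) = a 0 (x 0) := by simp [hr, hz]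
  have hr0' : r' 0 = a' 0 := by simp [hr', hz]
  have hcd : ∀ L K M N, pd L (christoffel (diagMetric h) K M N) x =
      if L = 0 then diagChristoffel a' r' K M N else 0 := by
    intro L K M N
    rw [pd_congr (f' := fun y => (fun t => diagChristoffel (fun M => a M t) (fun M => r M t) K M N)
      (y 0)) (hev.mono fun y hy => hc y hy K M N)]
    refine pd_time L (f := fun t => diagChristoffel (fun M => a M t) (fun M => r M t) K M N) ?_
    refine HasDerivAt.sub (HasDerivAt.add ?_ ?_) ?_
    all_goals split_ifs <;> first | exact ha _ | exact hrd _ | exact hasDerivAt_const _ _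
  simp only [ricci, hcd, hc x hx, Finset.sum_add_distrib, Finset.sum_sub_distrib]
  have htr := sum_diagChristoffel_trace (fun M => a M (x 0)) (fun M => r M (x 0)) hr0
  rw [sum_diagChristoffel_quadratic _ _ hr0, Finset.sum_comm]
  have h1 : ∑ K, (if K = 0 then diagChristoffel a' r' K M N else 0) =
      diagChristoffel a' r' 0 M N := by simp
  have h2 : ∑ K, (if N = 0 then diagChristoffel a' r' K M K else 0) =
      if N = 0 then if M = 0 then ∑ K, a' K else 0 else 0 := by
    rw [← sum_diagChristoffel_trace' a' r' hr0']
    split_ifs <;> simp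
  rw [h1, h2]
  simp only [← Finset.sum_mul, htr, ite_mul, zero_mul, Finset.sum_ite_eq', Finset.mem_univ,
    if_true]
  simp only [diagChristoffel, if_true]
  by_cases hMN : M = N
  · subst hMN
    by_cases hM : M = 0
    · subst hM
      simp [hr0, hr0']
      ring
    · simp [hM, hr', hr]
      field_simp
      ring
  · by_cases hM : M = 0
    · subst hM
      simp [hMN, Ne.symm hMN]
    · simp [hMN, hM, Ne.symm hM]

/-! ### Contractions of coordinate forms -/

theorem coordForm_basisVec {k : ℕ} (a I : Fin k → Fin 11) :
    coordForm a (fun j => basisVec (I j)) =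
      Matrix.det (Matrix.of fun i j => if I i = a j then (1 : ℝ) else 0) := by
  rw [coordForm_apply]
  congr 1
  ext i j
  simp [basisVec, Pi.single_apply, eq_comm]

theorem coordForm_basisVec_self {k : ℕ} {a : Fin k → Fin 11} (ha : Function.Injective a) :
    coordForm a (fun j => basisVec (a j)) = 1 := by
  rw [coordForm_basisVec]
  simp only [ha.eq_iff]
  exact Matrix.det_one

theorem coordForm_basisVec_eq_zero {k : ℕ} {a I : Fin k → Fin 11} (i : Fin k)
    (hi : ∀ j, I i ≠ a j) : coordForm a (fun j => basisVec (I j)) = 0 := by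
  rw [coordForm_basisVec]
  exact Matrix.det_eq_zero_of_row_eq_zero i fun j => by simp [hi j]

/-- Contracting an antisymmetric array with a coordinate form. -/
theorem sum_coordForm_mul {k : ℕ} (a : Fin k → Fin 11) (G : (Fin k → Fin 11) → ℝ)
    (hG : ∀ (σ : Equiv.Perm (Fin k)) I, G (I ∘ σ) = (Equiv.Perm.sign σ : ℤ) * G I) :
    ∑ I : Fin k → Fin 11, coordForm a (fun j => basisVec (I j)) * G I =
      (Nat.factorial k : ℝ) * G a := by
  simp only [coordForm_basisVec, Matrix.det_apply', Finset.sum_mul]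
  rw [Finset.sum_comm]
  have : ∀ σ : Equiv.Perm (Fin k), ∑ I : Fin k → Fin 11, ((Equiv.Perm.sign σ : ℤ) : ℝ) *
      (∏ i, (Matrix.of fun i j => if I i = a j then (1 : ℝ) else 0) (σ i) i) * G I = G a := by
    intro σ
    -- For fixed `σ` only one multi-index survives the Kronecker deltas, and the sign from
    -- antisymmetry of `G` cancels the sign in the determinant.
    rw [Finset.sum_eq_single (a ∘ σ.symm)]
    · rw [hG]
      have h1 : (((Equiv.Perm.sign σ : ℤ) : ℝ)) * ((Equiv.Perm.sign σ : ℤ) : ℝ) = 1 := by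
        rcases Int.units_eq_one_or (Equiv.Perm.sign σ) with h | h <;> simp [h]
      simp only [Matrix.of_apply, Function.comp_apply, Equiv.symm_apply_apply, if_true,
        Finset.prod_const_one, mul_one, Equiv.Perm.sign_symm]
      rw [← mul_assoc, h1, one_mul]
    · intro I _ hI
      have : ∃ i, I (σ i) ≠ a i := by
        by_contra! h
        exact hI (funext fun j => by simpa using h (σ.symm j))
      obtain ⟨i, hi⟩ := this
      rw [Finset.prod_eq_zero (Finset.mem_univ i) (by simp [hi])]
      simp
    · simp
  simp only [this, Finset.sum_const, Finset.card_univ, Fintype.card_perm, Fintype.card_fin,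
    nsmul_eq_mul]

theorem comp_comp_perm {k : ℕ} (F : FormField k) (x : Pt) (σ : Equiv.Perm (Fin k))
    (I : Fin k → Fin 11) : comp F x (I ∘ σ) = (Equiv.Perm.sign σ : ℤ) * comp F x I := by
  have := (F x).toAlternatingMap.map_perm (fun j => basisVec (I j)) σ
  simp only [ContinuousAlternatingMap.coe_toAlternatingMap] at this
  rw [comp, comp, ← zsmul_eq_mul]
  exact this

theorem raised_diagMetric {h : Fin 11 → ℝ → ℝ} {x : Pt} (hx : ∀ M, h M (x 0) ≠ 0) {k : ℕ}
    (F : FormField k) (I : Fin k → Fin 11) :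
    raised (diagMetric h) F x I = (∏ j, (h (I j) (x 0))⁻¹) * comp F x I := by
  rw [raised, Finset.sum_eq_single I]
  · simp [diagMetric_inv hx]
  · intro J _ hJ
    obtain ⟨j, hj⟩ := Function.ne_iff.1 hJ.symm
    rw [Finset.prod_eq_zero (Finset.mem_univ j), zero_mul]
    simp [diagMetric_inv hx, hj]
  · simp

/-- A weighted sum of coordinate forms. -/
def coordSum {m k : ℕ} (p : Fin m → Pt → ℝ) (a : Fin m → Fin k → Fin 11) : FormField k :=
  fun x => ∑ s, p s x • coordForm (a s)

theorem coordSum_apply {m k : ℕ} (p : Fin m → Pt → ℝ) (a : Fin m → Fin k → Fin 11) (x : Pt)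
    (v : Fin k → Pt) : coordSum p a x v = ∑ s, p s x * coordForm (a s) v := by
  simp [coordSum, ContinuousAlternatingMap.sum_apply]

theorem comp_coordSum {m k : ℕ} (p : Fin m → Pt → ℝ) (a : Fin m → Fin k → Fin 11) (x : Pt)
    (I : Fin k → Fin 11) :
    comp (coordSum p a) x I = ∑ s, p s x * coordForm (a s) (fun j => basisVec (I j)) :=
  coordSum_apply ..

theorem prod_comp_perm {k : ℕ} (w : Fin 11 → ℝ) (σ : Equiv.Perm (Fin k)) (I : Fin k → Fin 11) :
    ∏ j, w ((I ∘ σ) j) = ∏ j, w (I j) :=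
  Equiv.prod_comp σ fun j => w (I j)

/-- Only one factor is expanded into coordinate forms; the other stays an antisymmetric array, so
`sum_coordForm_mul` collapses the sum over all multi-indices. -/
theorem normSq_coordSum {h : Fin 11 → ℝ → ℝ} {x : Pt} (hx : ∀ M, h M (x 0) ≠ 0) {m k : ℕ}
    (p : Fin m → Pt → ℝ) (a : Fin m → Fin k → Fin 11) :
    normSq (diagMetric h) (coordSum p a) x = (Nat.factorial k : ℝ) *
      ∑ s, p s x * ((∏ j, (h (a s j) (x 0))⁻¹) * comp (coordSum p a) x (a s)) := by
  simp only [normSq, raised_diagMetric hx]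
  have h1 : ∀ I, comp (coordSum p a) x I * ((∏ j, (h (I j) (x 0))⁻¹) * comp (coordSum p a) x I) =
      ∑ s, p s x * (coordForm (a s) (fun j => basisVec (I j)) *
        ((∏ j, (h (I j) (x 0))⁻¹) * comp (coordSum p a) x I)) := by
    intro I
    conv_lhs => arg 1; rw [comp_coordSum]
    rw [Finset.sum_mul]
    exact Finset.sum_congr rfl fun s _ => mul_assoc _ _ _
  simp only [h1]
  rw [Finset.sum_comm, Finset.mul_sum]
  refine Finset.sum_congr rfl fun s _ => ?_
  rw [← Finset.mul_sum, sum_coordForm_mul (a s) fun I =>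
    (∏ j, (h (I j) (x 0))⁻¹) * comp (coordSum p a) x I]
  · ring
  · intro σ I
    rw [comp_comp_perm, prod_comp_perm fun M => (h M (x 0))⁻¹]
    ring

theorem coordForm_cons {k : ℕ} (a : Fin (k + 1) → Fin 11) (v : Fin (k + 1) → Pt) :
    coordForm a v = ∑ j : Fin (k + 1), (-1) ^ (j : ℕ) * v 0 (a j) *
      coordForm (a ∘ j.succAbove) (fun i => v i.succ) := by
  rw [coordForm_apply, Matrix.det_succ_row_zero]
  rfl

/-- As for `normSq_coordSum`, after a Laplace expansion splits off the free index `M`; the factor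
`6` is `3!`. -/
theorem contractPair_coordSum {h : Fin 11 → ℝ → ℝ} {x : Pt} (hx : ∀ M, h M (x 0) ≠ 0) {m : ℕ}
    (p : Fin m → Pt → ℝ) (a : Fin m → Fin 4 → Fin 11) (M N : Fin 11) :
    contractPair (diagMetric h) (coordSum p a) x M N =
      6 * ∑ s, p s x * ∑ j : Fin 4, (-1) ^ (j : ℕ) * (if M = a s j then 1 else 0) *
        ((∏ i, (h (a s (j.succAbove i)) (x 0))⁻¹) *
          comp (coordSum p a) x (Fin.cons N (a s ∘ j.succAbove))) := by
  have h1 : ∀ K : Fin 3 → Fin 11, ∑ L : Fin 3 → Fin 11, (∏ j, (diagMetric h x)⁻¹ (K j) (L j)) *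
      (comp (coordSum p a) x (Fin.cons M K) * comp (coordSum p a) x (Fin.cons N L)) =
      (∏ j, (h (K j) (x 0))⁻¹) *
      (comp (coordSum p a) x (Fin.cons M K) * comp (coordSum p a) x (Fin.cons N K)) := by
    intro K
    rw [Finset.sum_eq_single K]
    · simp [diagMetric_inv hx]
    · intro J _ hJ
      obtain ⟨j, hj⟩ := Function.ne_iff.1 hJ.symm
      rw [Finset.prod_eq_zero (Finset.mem_univ j), zero_mul]
      simp [diagMetric_inv hx, hj]
    · simp
  have h2 : ∀ K : Fin 3 → Fin 11, comp (coordSum p a) x (Fin.cons M K) =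
      ∑ s, ∑ j : Fin 4, p s x * ((-1) ^ (j : ℕ) * (if M = a s j then 1 else 0) *
        coordForm (a s ∘ j.succAbove) (fun i => basisVec (K i))) := by
    intro K
    rw [comp_coordSum]
    refine Finset.sum_congr rfl fun s _ => ?_
    rw [coordForm_cons, Finset.mul_sum]
    simp [basisVec, Pi.single_apply, eq_comm]
  rw [contractPair]
  simp only [h1]
  conv_lhs => enter [2, K]; rw [h2 K]
  simp only [Finset.sum_mul, Finset.mul_sum]
  rw [Finset.sum_comm]
  refine Finset.sum_congr rfl fun s _ => ?_
  rw [Finset.sum_comm]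
  refine Finset.sum_congr rfl fun j _ => ?_
  have h3 := sum_coordForm_mul (a s ∘ j.succAbove) (fun K => (∏ j, (h (K j) (x 0))⁻¹) *
    comp (coordSum p a) x (Fin.cons N K)) ?_
  · rw [show ((Nat.factorial 3 : ℕ) : ℝ) = 6 by norm_num [Nat.factorial]] at h3
    calc _ = ∑ K : Fin 3 → Fin 11, (p s x * ((-1) ^ (j : ℕ) * (if M = a s j then 1 else 0))) *
        (coordForm (a s ∘ j.succAbove) (fun i => basisVec (K i)) * ((∏ j, (h (K j) (x 0))⁻¹) *
          comp (coordSum p a) x (Fin.cons N K))) := Finset.sum_congr rfl fun K _ => by ring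
      _ = _ := by
        rw [← Finset.mul_sum, h3]
        simp only [Function.comp_apply]
        ring
  · intro σ I
    rw [prod_comp_perm fun M => (h M (x 0))⁻¹]
    have h4 : comp (coordSum p a) x (Fin.cons N (I ∘ σ)) =
        ((Equiv.Perm.sign σ : ℤ) : ℝ) * comp (coordSum p a) x (Fin.cons N I) := by
      -- Contracting with `∂_N` gives a 3-form, so antisymmetry in the last three indices is
      -- inherited.
      have := comp_comp_perm (fun y => (coordSum p a y).curryLeft (basisVec N)) x σ I
      simp only [comp, ContinuousAlternatingMap.curryLeft_apply_apply] at this ⊢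
      convert this using 2
      · ext j : 1; refine Fin.cases ?_ (fun i => ?_) j <;> rfl
      · congr 1; ext j : 1; refine Fin.cases ?_ (fun i => ?_) j <;> rfl
    rw [h4]
    ring

/-! ### The wedge square -/

/-- Expanding both 4×4 determinants turns the sum over `σ` into 8×8 determinants, each with two
equal columns coming from the shared index. -/
theorem sum_sign_coordForm_mul_coordForm {a b : Fin 4 → Fin 11} {i j : Fin 4} (hab : a i = b j)
    (v : Fin 8 → Pt) :
    ∑ σ : Equiv.Perm (Fin 8), ((Equiv.Perm.sign σ : ℤ) : ℝ) *
      (coordForm a ![v (σ 0), v (σ 1), v (σ 2), v (σ 3)] *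
        coordForm b ![v (σ 4), v (σ 5), v (σ 6), v (σ 7)]) = 0 := by
  have key : ∀ τ ρ : Equiv.Perm (Fin 4), ∑ σ : Equiv.Perm (Fin 8),
      ((Equiv.Perm.sign σ : ℤ) : ℝ) *
        ((∏ k, (![v (σ 0), v (σ 1), v (σ 2), v (σ 3)] k) (a (τ k))) *
          ∏ k, (![v (σ 4), v (σ 5), v (σ 6), v (σ 7)] k) (b (ρ k))) = 0 := by
    intro τ ρ
    let c : Fin 8 → Fin 11 := Fin.append (a ∘ τ) (b ∘ ρ)
    have hdet : Matrix.det (Matrix.of fun k l : Fin 8 => v k (c l)) = 0 := by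
      refine Matrix.det_zero_of_column_eq
        (i := Fin.castAdd 4 (τ.symm i)) (j := Fin.natAdd 4 (ρ.symm j)) ?_ fun k => ?_
      · intro h
        have := congrArg Fin.val h
        simp at this
        omega
      · simp only [Matrix.of_apply, c]
        erw [Fin.append_left, Fin.append_right]
        simp [hab]
    rw [Matrix.det_apply'] at hdet
    rw [← hdet]
    refine Finset.sum_congr rfl fun σ _ => ?_
    congr 1
    rw [Fin.prod_univ_four, Fin.prod_univ_four, Fin.prod_univ_eight]
    simp only [Matrix.of_apply, c, mul_assoc]
    rfl
  simp only [coordForm_apply]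
  conv_lhs =>
    enter [2, σ]
    rw [← Matrix.det_transpose, ← Matrix.det_transpose (Matrix.of fun i j =>
      (![v (σ 4), v (σ 5), v (σ 6), v (σ 7)] i) (b j)), Matrix.det_apply', Matrix.det_apply',
      Finset.sum_mul_sum, Finset.mul_sum]
  rw [Finset.sum_comm]
  refine Finset.sum_eq_zero fun τ _ => ?_
  simp only [Finset.mul_sum]
  rw [Finset.sum_comm]
  refine Finset.sum_eq_zero fun ρ _ => ?_
  refine Eq.trans ?_ (mul_eq_zero_of_right
    (((Equiv.Perm.sign τ : ℤ) : ℝ) * ((Equiv.Perm.sign ρ : ℤ) : ℝ)) (key τ ρ))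
  rw [Finset.mul_sum]
  refine Finset.sum_congr rfl fun σ _ => ?_
  simp only [Matrix.transpose_apply, Matrix.of_apply]
  ring

theorem wedgeSelf_coordSum {m : ℕ} (p : Fin m → Pt → ℝ) (a : Fin m → Fin 4 → Fin 11)
    (ha : ∀ s s', ∃ i j, a s i = a s' j) (x : Pt) (v : Fin 8 → Pt) :
    wedgeSelf (coordSum p a) x v = 0 := by
  simp only [wedgeSelf, coordSum_apply, Finset.sum_mul_sum]
  simp only [Finset.mul_sum]
  rw [Finset.sum_comm]
  refine Finset.sum_eq_zero fun s _ => ?_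
  rw [Finset.sum_comm]
  refine Finset.sum_eq_zero fun s' _ => ?_
  obtain ⟨i, j, hij⟩ := ha s s'
  refine Eq.trans ?_ (mul_eq_zero_of_right ((1 / ((Nat.factorial 4 : ℝ) * Nat.factorial 4)) *
    (p s x * p s' x)) (sum_sign_coordForm_mul_coordForm hij v))
  rw [Finset.mul_sum]
  exact Finset.sum_congr rfl fun σ _ => by ring

/-! ### Exterior derivative -/

theorem hasFDerivAt_coordSum_time {m k : ℕ} {ψ : Fin m → ℝ → ℝ} {ψ' : Fin m → ℝ} {x : Pt}
    (hψ : ∀ s, HasDerivAt (ψ s) (ψ' s) (x 0)) (a : Fin m → Fin k → Fin 11) :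
    HasFDerivAt (coordSum (fun s y => ψ s (y 0)) a)
      (∑ s, (ψ' s • (ContinuousLinearMap.proj 0 : Pt →L[ℝ] ℝ)).smulRight (coordForm (a s))) x := by
  exact HasFDerivAt.fun_sum fun s _ => (hasFDerivAt_time (hψ s)).smul_const (coordForm (a s))

/-- The alternating sum defining `d` is the Laplace expansion of the larger determinant along its
`dt` column. -/
theorem extDeriv_coordSum_time {m k : ℕ} {ψ : Fin m → ℝ → ℝ} {ψ' : Fin m → ℝ} {x : Pt}
    (hψ : ∀ s, HasDerivAt (ψ s) (ψ' s) (x 0)) (a : Fin m → Fin k → Fin 11) :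
    extDeriv (coordSum (fun s y => ψ s (y 0)) a) x =
      ∑ s, ψ' s • coordForm (Fin.cons 0 (a s) : Fin (k + 1) → Fin 11) := by
  ext v
  rw [extDeriv, (hasFDerivAt_coordSum_time hψ a).fderiv,
    ContinuousAlternatingMap.alternatizeUncurryFin_apply]
  simp only [ContinuousAlternatingMap.sum_apply, ContinuousAlternatingMap.smul_apply,
    _root_.sum_apply, ContinuousLinearMap.smulRight_apply, coordForm_apply,
    Matrix.det_succ_column_zero, Finset.smul_sum]
  rw [Finset.sum_comm]
  refine Finset.sum_congr rfl fun s _ => Finset.sum_congr rfl fun i _ => ?_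
  have h1 : (Matrix.of fun i j => v i ((Fin.cons 0 (a s) : Fin (k + 1) → Fin 11) j)).submatrix
      i.succAbove Fin.succ = Matrix.of fun l j => i.removeNth v l (a s j) := by
    ext l j
    simp [Fin.removeNth]
  rw [h1]
  simp
  ring

theorem contDiffOn_time {f : ℝ → ℝ} {J : Set ℝ} (hf : ContDiffOn ℝ ∞ f J) :
    ContDiffOn ℝ ∞ (fun x : Pt => f (x 0)) (region J) :=
  hf.comp (contDiff_apply ℝ ℝ 0).contDiffOn fun _ hx => hx

theorem contDiffOn_coordSum {m k : ℕ} {p : Fin m → Pt → ℝ} {U : Set Pt}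
    (hp : ∀ s, ContDiffOn ℝ ∞ (p s) U) (a : Fin m → Fin k → Fin 11) :
    ContDiffOn ℝ ∞ (coordSum p a) U :=
  ContDiffOn.sum fun s _ => (hp s).smul contDiffOn_const

/-- Scaling rows by `w (I i)` or columns by `w (a j)` gives the same matrix, since its entries
vanish unless `I i = a j`. -/
theorem coordForm_mul_prod {k : ℕ} (a I : Fin k → Fin 11) (w : Fin 11 → ℝ) :
    (∏ j, w (I j)) * coordForm a (fun j => basisVec (I j)) =
      (∏ j, w (a j)) * coordForm a (fun j => basisVec (I j)) := by
  rw [coordForm_basisVec, ← Matrix.det_mul_column, ← Matrix.det_mul_row]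
  congr 1
  ext i j
  by_cases h : I i = a j <;> simp [h]

theorem coordForm_basisVec_cons {k : ℕ} {a : Fin (k + 1) → Fin 11} (ha : Function.Injective a)
    (N : Fin 11) (j : Fin (k + 1)) :
    coordForm a (fun i => basisVec ((Fin.cons N (a ∘ j.succAbove) : Fin (k + 1) → Fin 11) i)) =
      (-1) ^ (j : ℕ) * if N = a j then 1 else 0 := by
  rw [coordForm_cons, Finset.sum_eq_single j]
  · simp only [Fin.cons_succ, Fin.cons_zero]
    rw [coordForm_basisVec_self (ha.comp Fin.succAbove_right_injective)]
    simp [basisVec, Pi.single_apply, eq_comm]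
  · intro l _ hl
    obtain ⟨i, hi⟩ := Fin.exists_succAbove_eq hl
    simp only [Fin.cons_succ]
    rw [coordForm_basisVec_eq_zero i, mul_zero]
    intro m h
    simp only [Function.comp_apply, hi] at h
    exact Fin.succAbove_ne l m (ha h).symm
  · simp

/-! ### The Toda chain -/

theorem cartanR_comm (s s' : Fin 4) : cartanR s s' = cartanR s' s := by
  fin_cases s <;> fin_cases s' <;> simp [cartanR, cartan]

section Toda

variable {Q : Fin 4 → ℝ} {J : Set ℝ} {q : Fin 4 → ℝ → ℝ}

theorem IsTodaSolution.hasDerivAt (hq : IsTodaSolution Q J q) (s : Fin 4) {t : ℝ} (ht : t ∈ J) :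
    HasDerivAt (q s) (deriv (q s) t) t :=
  (hq s t ht).1.hasDerivAt

theorem IsTodaSolution.hasDerivAt_todaExp (hq : IsTodaSolution Q J q) (s : Fin 4) {t : ℝ}
    (ht : t ∈ J) :
    HasDerivAt (todaExp q s) (todaExp q s t * ∑ s', cartanR s s' * deriv (q s') t) t :=
  (HasDerivAt.fun_sum fun s' _ => (hq.hasDerivAt s' ht).const_mul (cartanR s s')).exp

/-- By symmetry of `A`, the kinetic part changes at rate `-½ ∑ Q_s² todaExp · A q̇`, opposite to the
potential part. -/
theorem IsTodaSolution.hasDerivAt_todaEnergy (hq : IsTodaSolution Q J q) {t : ℝ} (ht : t ∈ J) :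
    HasDerivAt (todaEnergy Q q) 0 t := by
  have h1 := HasDerivAt.fun_sum (u := Finset.univ) fun (s : Fin 4) _ =>
    HasDerivAt.fun_sum (u := Finset.univ) fun (s' : Fin 4) _ =>
      (((hq s t ht).2.const_mul (cartanR s s')).mul (hq s' t ht).2)
  have h2 := HasDerivAt.fun_sum (u := Finset.univ) fun (s : Fin 4) _ =>
    (hq.hasDerivAt_todaExp s ht).const_mul (Q s ^ 2)
  refine ((h1.const_mul (1 / 8)).add (h2.const_mul (1 / 2))).congr_deriv ?_
  simp only [Fin.sum_univ_four]
  rw [cartanR_comm 1 0, cartanR_comm 2 0, cartanR_comm 3 0, cartanR_comm 2 1, cartanR_comm 3 1,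
    cartanR_comm 3 2]
  ring

theorem IsTodaSolution.exists_todaEnergy_eq (hq : IsTodaSolution Q J q) (hJ : IsOpen J)
    (hJc : J.OrdConnected) : ∃ E : ℝ, ∀ t ∈ J, todaEnergy Q q t = E :=
  hJ.exists_is_const_of_deriv_eq_zero hJc.isPreconnected
    (fun _ ht => (hq.hasDerivAt_todaEnergy ht).differentiableAt.differentiableWithinAt)
    fun _ ht => (hq.hasDerivAt_todaEnergy ht).deriv

theorem contDiffOn_todaExp {n : WithTop ℕ∞} (hq : ∀ s, ContDiffOn ℝ n (q s) J) (s : Fin 4) :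
    ContDiffOn ℝ n (todaExp q s) J :=
  (ContDiffOn.sum fun s' _ => contDiffOn_const.mul (hq s')).exp

/-- Bootstrap: the right-hand side of the Toda equation is as regular as `q`, so carrying `q` and
its derivative together gains one order per step. -/
theorem IsTodaSolution.contDiffOn_nat (hq : IsTodaSolution Q J q) (hJ : IsOpen J) (n : ℕ) :
    ∀ s, ContDiffOn ℝ n (q s) J ∧ ContDiffOn ℝ n (deriv (q s)) J := by
  induction n with
  | zero =>
    refine fun s => ⟨contDiffOn_zero.2 fun t ht => ?_, contDiffOn_zero.2 fun t ht => ?_⟩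
    · exact (hq s t ht).1.continuousAt.continuousWithinAt
    · exact (hq s t ht).2.continuousAt.continuousWithinAt
  | succ n ih =>
    intro s
    push_cast
    refine ⟨(contDiffOn_succ_iff_deriv_of_isOpen hJ).2 ⟨fun t ht => ?_, by simp, (ih s).2⟩,
      (contDiffOn_succ_iff_deriv_of_isOpen hJ).2 ⟨fun t ht => ?_, by simp, ?_⟩⟩
    · exact (hq s t ht).1.differentiableWithinAt
    · exact (hq s t ht).2.differentiableAt.differentiableWithinAt
    · exact (contDiffOn_const.mul (contDiffOn_todaExp (fun s => (ih s).1) s)).congr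
        fun t ht => (hq s t ht).2.deriv

theorem IsTodaSolution.contDiffOn (hq : IsTodaSolution Q J q) (hJ : IsOpen J) (s : Fin 4) :
    ContDiffOn ℝ ∞ (q s) J :=
  contDiffOn_infty.2 fun n => (hq.contDiffOn_nat hJ n s).1

theorem IsTodaSolution.contDiffOn_deriv (hq : IsTodaSolution Q J q) (hJ : IsOpen J) (s : Fin 4) :
    ContDiffOn ℝ ∞ (deriv (q s)) J :=
  contDiffOn_infty.2 fun n => (hq.contDiffOn_nat hJ n s).2

end Toda

/-! ### Combinatorics of the brane sets -/

/-- The indicator of the brane set `I_s`. -/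
noncomputable def braneInd (s : Fin 4) (M : Fin 11) : ℝ := if M ∈ braneSet s then 1 else 0

theorem braneInd_zero (s : Fin 4) : braneInd s 0 = 0 := by
  have : ∀ s, (0 : Fin 11) ∉ braneSet s := by decide
  simp [braneInd, this s]

theorem sum_braneInd_mul (s : Fin 4) (w : Fin 11 → ℝ) :
    ∑ M, braneInd s M * w M = ∑ M ∈ braneSet s, w M := by
  simp [braneInd]

theorem sum_braneInd (s : Fin 4) : ∑ M, braneInd s M = 3 := by
  simp [braneInd, card_braneSet]

theorem sum_braneInd_mul_braneInd (s s' : Fin 4) :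
    ∑ M, braneInd s M * braneInd s' M = 1 + cartanR s s' := by
  rw [sum_braneInd_mul, ← card_braneSet_inter]
  simp [braneInd]

theorem braneIndex_injective (s : Fin 4) : Function.Injective (braneIndex s) := by
  have : ∀ s : Fin 4, ∀ i j : Fin 4, braneIndex s i = braneIndex s j → i = j := by decide
  exact fun i j h => this s i j h

theorem prod_braneIndex (s : Fin 4) (w : Fin 11 → ℝ) :
    ∏ j, w (braneIndex s j) = w 0 * ∏ M ∈ braneSet s, w M := by
  fin_cases s <;> simp [braneIndex, braneSet, Fin.prod_univ_four, mul_assoc]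

theorem sum_ite_braneIndex (s : Fin 4) (M : Fin 11) :
    ∑ j, (if M = braneIndex s j then (1 : ℝ) else 0) =
      braneInd s M + if M = 0 then 1 else 0 := by
  have h : ∀ s : Fin 4, ∀ M : Fin 11, ∑ j, (if M = braneIndex s j then 1 else 0) =
      (if M ∈ braneSet s then 1 else 0) + if M = 0 then 1 else 0 := by decide
  rw [braneInd]
  exact_mod_cast h s M

theorem cons_zero_braneIndex (s : Fin 4) :
    (Fin.cons 0 (fun j => braneIndex s j.succ) : Fin 4 → Fin 11) = braneIndex s := by
  ext j
  fin_cases s <;> fin_cases j <;> rfl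

theorem comp_braneIndex (p : Fin 4 → Pt → ℝ) (x : Pt) (s : Fin 4) :
    comp (coordSum p braneIndex) x (braneIndex s) = p s x := by
  rw [comp_coordSum, Finset.sum_eq_single s]
  · rw [coordForm_basisVec_self (braneIndex_injective s), mul_one]
  · intro s' _ hs
    have : ∀ s s' : Fin 4, s' ≠ s → ∃ i, ∀ j, braneIndex s i ≠ braneIndex s' j := by decide
    obtain ⟨i, hi⟩ := this s s' hs
    rw [coordForm_basisVec_eq_zero i hi, mul_zero]
  · simp

/-- Distinct branes share at most two indices, time included, so any three indices of one brane
exclude all others. This is what makes the stress tensor diagonal. -/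
theorem comp_cons_braneIndex (p : Fin 4 → Pt → ℝ) (x : Pt) (s : Fin 4) (N : Fin 11)
    (j : Fin 4) :
    comp (coordSum p braneIndex) x (Fin.cons N (braneIndex s ∘ j.succAbove)) =
      p s x * ((-1) ^ (j : ℕ) * if N = braneIndex s j then 1 else 0) := by
  rw [comp_coordSum, Finset.sum_eq_single s]
  · rw [coordForm_basisVec_cons (braneIndex_injective s)]
  · intro s' _ hs
    have : ∀ s s' : Fin 4, s' ≠ s → ∀ j : Fin 4, ∃ i : Fin 3, ∀ k,
        braneIndex s (j.succAbove i) ≠ braneIndex s' k := by decide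
    obtain ⟨i, hi⟩ := this s s' hs j
    rw [coordForm_basisVec_eq_zero i.succ (by simpa using hi), mul_zero]
  · simp

/-! ### The field equations -/

/-- The logarithm `φ^M` of the scale factor of the coordinate `x^M`. -/
noncomputable def logScale (q : Fin 4 → ℝ → ℝ) (c cbar : Fin 11 → ℝ) (M : Fin 11) (t : ℝ) : ℝ :=
  ∑ s, (braneInd s M / 2 - 1 / 6) * q s t + (c M * t + cbar M)

/-- The derivative of `logScale`. -/
noncomputable def logScaleDeriv (q : Fin 4 → ℝ → ℝ) (c : Fin 11 → ℝ) (M : Fin 11) (t : ℝ) : ℝ :=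
  ∑ s, (braneInd s M / 2 - 1 / 6) * deriv (q s) t + c M

/-- The diagonal entries of `braneMetric`. -/
noncomputable def braneMetricEntry (f : Fin 4 → ℝ → ℝ) (c cbar : Fin 11 → ℝ) (M : Fin 11)
    (t : ℝ) : ℝ :=
  (∏ s, f s t) ^ (1 / 3 : ℝ) *
    ((if M = 0 then -1 else (∏ s with M ∈ braneSet s, f s t)⁻¹) *
      Real.exp (2 * c M * t + 2 * cbar M))

theorem braneMetric_eq (f : Fin 4 → ℝ → ℝ) (c cbar : Fin 11 → ℝ) :
    braneMetric f c cbar = diagMetric (braneMetricEntry f c cbar) := rfl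

/-- The coefficients of `braneForm`. -/
noncomputable def braneCoeff (Q : Fin 4 → ℝ) (f : Fin 4 → ℝ → ℝ) (s : Fin 4) (t : ℝ) : ℝ :=
  Q s * ∏ s', f s' t ^ (-cartan s s')

theorem braneForm_eq (Q : Fin 4 → ℝ) (f : Fin 4 → ℝ → ℝ) :
    braneForm Q f = coordSum (fun s x => braneCoeff Q f s (x 0)) braneIndex := rfl

theorem wedgeSelf_braneForm (Q : Fin 4 → ℝ) (f : Fin 4 → ℝ → ℝ) (x : Pt) (v : Fin 8 → Pt) :
    wedgeSelf (braneForm Q f) x v = 0 := by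
  refine wedgeSelf_coordSum _ _ (fun s s' => ⟨0, 0, ?_⟩) x v
  revert s s'
  decide

theorem braneMetricEntry_eq {f q : Fin 4 → ℝ → ℝ} {t : ℝ} (hf : ∀ s, f s t = Real.exp (-q s t))
    (c cbar : Fin 11 → ℝ) (M : Fin 11) :
    braneMetricEntry f c cbar M t =
      (if M = 0 then -1 else 1) * Real.exp (2 * logScale q c cbar M t) := by
  have h1 : ∏ s with M ∈ braneSet s, f s t = Real.exp (-∑ s, braneInd s M * q s t) := by
    simp only [hf, ← Real.exp_sum, Finset.sum_neg_distrib, Finset.sum_filter, braneInd, ite_mul,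
      one_mul, zero_mul]
  have h2 : (∏ s, f s t) ^ (1 / 3 : ℝ) = Real.exp (-(1 / 3) * ∑ s, q s t) := by
    simp only [hf, ← Real.exp_sum, Finset.sum_neg_distrib]
    rw [← Real.exp_mul]
    ring_nf
  have h3 : 2 * logScale q c cbar M t = -(1 / 3) * ∑ s, q s t + (∑ s, braneInd s M * q s t +
      (2 * c M * t + 2 * cbar M)) := by
    simp only [logScale, Fin.sum_univ_four]
    ring
  rw [braneMetricEntry, h1, h2, h3]
  generalize 2 * c M * t + 2 * cbar M = z
  rw [Real.exp_add, Real.exp_add, ← Real.exp_neg, neg_neg]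
  split_ifs with hM
  · subst hM
    simp [braneInd_zero]
  · ring

theorem braneCoeff_eq {f q : Fin 4 → ℝ → ℝ} {t : ℝ} (hf : ∀ s, f s t = Real.exp (-q s t))
    (Q : Fin 4 → ℝ) (s : Fin 4) : braneCoeff Q f s t = Q s * todaExp q s t := by
  rw [braneCoeff, todaExp, Real.exp_sum]
  congr 1
  refine Finset.prod_congr rfl fun s' _ => ?_
  rw [hf, ← Real.rpow_intCast, ← Real.exp_mul, cartanR, Matrix.map_apply]
  push_cast
  ring_nf

theorem sum_eq_two_mul_of_constraints {c : Fin 11 → ℝ} (hc : BraneConstraints c) :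
    ∑ M, c M = 2 * c 0 := by
  rw [Fin.sum_univ_succ, ← hc.1]
  ring

/-- The harmonic gauge condition. -/
theorem sum_braneInd_harmonic (w : Fin 4 → ℝ) {c : Fin 11 → ℝ} (hc : ∑ M, c M = 2 * c 0) :
    ∑ M, (∑ s, (braneInd s M / 2 - 1 / 6) * w s + c M) =
      2 * (∑ s, (braneInd s 0 / 2 - 1 / 6) * w s + c 0) := by
  rw [Finset.sum_add_distrib, Finset.sum_comm, hc, mul_add, Finset.mul_sum]
  congr 1
  -- Coefficient of `w s`: `3/2 - 11/6 = -1/3 = 2 · (-1/6)`.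
  refine Finset.sum_congr rfl fun s _ => ?_
  rw [← Finset.sum_mul, Finset.sum_sub_distrib, ← Finset.sum_div, sum_braneInd, braneInd_zero]
  simp
  ring

/-- The brane constraints remove `c` and `cbar`; the coefficient of `q^{s'}` is `2 ((1 + A_{ss'})/2
- 3/6) = A_{ss'}` by the intersection rule. -/
theorem sum_logScale_braneSet {q : Fin 4 → ℝ → ℝ} {c cbar : Fin 11 → ℝ} (hc : BraneConstraints c)
    (hcbar : BraneConstraints cbar) (s : Fin 4) (t : ℝ) :
    2 * ∑ M ∈ braneSet s, logScale q c cbar M t = ∑ s', cartanR s s' * q s' t := by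
  simp only [logScale, Finset.sum_add_distrib]
  rw [← Finset.sum_mul, hc.2 s, hcbar.2 s, zero_mul, add_zero, add_zero, Finset.sum_comm,
    Finset.mul_sum]
  refine Finset.sum_congr rfl fun s' _ => ?_
  have h1 : ∑ M ∈ braneSet s, braneInd s' M = 1 + cartanR s s' := by
    rw [← sum_braneInd_mul, sum_braneInd_mul_braneInd]
  rw [← Finset.sum_mul, Finset.sum_sub_distrib, ← Finset.sum_div, h1,
    Finset.sum_const, card_braneSet]
  simp
  ring

/-- This is the Hamiltonian constraint behind the `00` equation. The `1/18` terms and the cross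
terms with `c 0` cancel against `2 (φ̇⁰)²`, leaving `2E` minus the kinetic term `¼ ∑ A q̇ q̇`. -/
theorem sum_logScaleDeriv_sq {q : Fin 4 → ℝ → ℝ} {c : Fin 11 → ℝ} (hc : BraneConstraints c)
    {Q : Fin 4 → ℝ} {t : ℝ} (hE : EnergyConstraint (todaEnergy Q q t) c) :
    2 * logScaleDeriv q c 0 t ^ 2 - ∑ M, logScaleDeriv q c M t ^ 2 =
      ∑ s, Q s ^ 2 * todaExp q s t := by
  have hA : ∀ s s', ∑ M, (braneInd s M / 2 - 1 / 6) * (braneInd s' M / 2 - 1 / 6) =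
      cartanR s s' / 4 + 1 / 18 := by
    intro s s'
    have : ∀ M, (braneInd s M / 2 - 1 / 6) * (braneInd s' M / 2 - 1 / 6) =
        (1 / 4) * (braneInd s M * braneInd s' M) - (1 / 12) * braneInd s M -
          (1 / 12) * braneInd s' M + 1 / 36 := fun M => by ring
    simp only [this, Finset.sum_add_distrib, Finset.sum_sub_distrib, ← Finset.mul_sum,
      sum_braneInd_mul_braneInd, sum_braneInd]
    simp
    ring
  have hB : ∀ s, ∑ M, (braneInd s M / 2 - 1 / 6) * c M = -(1 / 3) * c 0 := by
    intro s
    have : ∀ M, (braneInd s M / 2 - 1 / 6) * c M =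
        (1 / 2) * (braneInd s M * c M) - (1 / 6) * c M := fun M => by ring
    simp only [this, Finset.sum_sub_distrib, ← Finset.mul_sum, sum_braneInd_mul, hc.2 s,
      sum_eq_two_mul_of_constraints hc]
    ring
  have h1 : ∑ M, logScaleDeriv q c M t ^ 2 =
      (∑ s, ∑ s', (cartanR s s' / 4 + 1 / 18) * (deriv (q s) t * deriv (q s') t))
        + 2 * (∑ s, (-(1 / 3) * c 0) * deriv (q s) t) + ∑ M, c M ^ 2 := by
    have h2 : ∀ M, logScaleDeriv q c M t ^ 2 =
        (∑ s, ∑ s', ((braneInd s M / 2 - 1 / 6) * (braneInd s' M / 2 - 1 / 6)) *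
          (deriv (q s) t * deriv (q s') t))
        + 2 * (∑ s, ((braneInd s M / 2 - 1 / 6) * c M) * deriv (q s) t) + c M ^ 2 := by
      intro M
      simp only [logScaleDeriv, Fin.sum_univ_four]
      ring
    have e1 : ∑ M, ∑ s, ∑ s', ((braneInd s M / 2 - 1 / 6) * (braneInd s' M / 2 - 1 / 6)) *
        (deriv (q s) t * deriv (q s') t) =
        ∑ s, ∑ s', (cartanR s s' / 4 + 1 / 18) * (deriv (q s) t * deriv (q s') t) := by
      rw [Finset.sum_comm]
      refine Finset.sum_congr rfl fun s _ => ?_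
      rw [Finset.sum_comm]
      refine Finset.sum_congr rfl fun s' _ => ?_
      rw [← Finset.sum_mul, hA]
    have e2 : ∑ M, ∑ s, ((braneInd s M / 2 - 1 / 6) * c M) * deriv (q s) t =
        ∑ s, (-(1 / 3) * c 0) * deriv (q s) t := by
      rw [Finset.sum_comm]
      refine Finset.sum_congr rfl fun s _ => ?_
      rw [← Finset.sum_mul, hB]
    simp only [h2, Finset.sum_add_distrib]
    rw [e1, ← Finset.mul_sum, e2]
  have hE' : ∑ M, c M ^ 2 = 2 * c 0 ^ 2 - 2 * todaEnergy Q q t := by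
    rw [EnergyConstraint, ← hc.1] at hE
    rw [Fin.sum_univ_succ]
    linarith
  rw [h1, hE', todaEnergy]
  simp only [logScaleDeriv, braneInd_zero, Fin.sum_univ_four]
  ring

/-- The pointwise data of the solution: on `J` the functions `f_s` are `exp (-q^s)` for a solution
`q` of the Toda chain, and the integration constants obey the brane and energy constraints. -/
structure IsBraneSolution (Q : Fin 4 → ℝ) (J : Set ℝ) (q f : Fin 4 → ℝ → ℝ)
    (c cbar : Fin 11 → ℝ) : Prop where
  isOpen : IsOpen J
  charge_ne_zero : ∀ s, Q s ≠ 0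
  toda : IsTodaSolution Q J q
  eq_exp : ∀ s, ∀ t ∈ J, f s t = Real.exp (-q s t)
  constraints : BraneConstraints c
  constraints_bar : BraneConstraints cbar
  energy : ∀ t ∈ J, EnergyConstraint (todaEnergy Q q t) c

namespace IsBraneSolution

variable {Q : Fin 4 → ℝ} {J : Set ℝ} {q f : Fin 4 → ℝ → ℝ} {c cbar : Fin 11 → ℝ}

theorem entry_eq (H : IsBraneSolution Q J q f c cbar) (M : Fin 11) {t : ℝ} (ht : t ∈ J) :
    braneMetricEntry f c cbar M t =
      (if M = 0 then -1 else 1) * Real.exp (2 * logScale q c cbar M t) :=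
  braneMetricEntry_eq (fun s => H.eq_exp s t ht) c cbar M

theorem coeff_eq (H : IsBraneSolution Q J q f c cbar) (s : Fin 4) {t : ℝ} (ht : t ∈ J) :
    braneCoeff Q f s t = Q s * todaExp q s t :=
  braneCoeff_eq (fun s => H.eq_exp s t ht) Q s

theorem entry_ne_zero (H : IsBraneSolution Q J q f c cbar) (M : Fin 11) {t : ℝ} (ht : t ∈ J) :
    braneMetricEntry f c cbar M t ≠ 0 := by
  rw [H.entry_eq M ht]
  split_ifs <;> simp

theorem contDiffOn_logScale (H : IsBraneSolution Q J q f c cbar) (M : Fin 11) :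
    ContDiffOn ℝ ∞ (logScale q c cbar M) J := by
  refine ContDiffOn.add (ContDiffOn.sum fun s _ => ?_) ?_
  · exact contDiffOn_const.mul (H.toda.contDiffOn H.isOpen s)
  · fun_prop

theorem contDiffOn_entry (H : IsBraneSolution Q J q f c cbar) (M : Fin 11) :
    ContDiffOn ℝ ∞ (braneMetricEntry f c cbar M) J :=
  (contDiffOn_const.mul (contDiffOn_const.mul (H.contDiffOn_logScale M)).exp).congr
    fun _ ht => H.entry_eq M ht

theorem hasDerivAt_logScale (H : IsBraneSolution Q J q f c cbar) (M : Fin 11) {t : ℝ}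
    (ht : t ∈ J) : HasDerivAt (logScale q c cbar M) (logScaleDeriv q c M t) t := by
  refine HasDerivAt.add (HasDerivAt.fun_sum fun s _ => ?_) ?_
  · exact (H.toda.hasDerivAt s ht).const_mul _
  · simpa using ((hasDerivAt_id t).const_mul (c M)).add_const (cbar M)

theorem hasDerivAt_entry (H : IsBraneSolution Q J q f c cbar) (M : Fin 11) {t : ℝ}
    (ht : t ∈ J) : HasDerivAt (braneMetricEntry f c cbar M)
      (2 * logScaleDeriv q c M t * braneMetricEntry f c cbar M t) t := by
  have h := ((H.hasDerivAt_logScale M ht).const_mul 2).exp.const_mul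
    (if M = 0 then (-1 : ℝ) else 1)
  refine (h.congr_of_eventuallyEq ?_).congr_deriv ?_
  · filter_upwards [H.isOpen.mem_nhds ht] with u hu using H.entry_eq M hu
  · rw [H.entry_eq M ht]
    ring

theorem hasDerivAt_logScaleDeriv (H : IsBraneSolution Q J q f c cbar) (M : Fin 11) {t : ℝ}
    (ht : t ∈ J) : HasDerivAt (logScaleDeriv q c M)
      (∑ s, (1 / 3 - braneInd s M) * (Q s ^ 2 * todaExp q s t)) t := by
  have h := (HasDerivAt.fun_sum (u := Finset.univ) fun (s : Fin 4) _ =>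
    (H.toda s t ht).2.const_mul (braneInd s M / 2 - 1 / 6)).add_const (c M)
  refine h.congr_deriv (Finset.sum_congr rfl fun s _ => by ring)

theorem prod_entry_inv (H : IsBraneSolution Q J q f c cbar) (s : Fin 4) {t : ℝ} (ht : t ∈ J) :
    ∏ j, (braneMetricEntry f c cbar (braneIndex s j) t)⁻¹ =
      (braneMetricEntry f c cbar 0 t)⁻¹ * (todaExp q s t)⁻¹ := by
  rw [prod_braneIndex s fun M => (braneMetricEntry f c cbar M t)⁻¹, Finset.prod_inv_distrib]
  congr 2
  rw [todaExp, ← sum_logScale_braneSet H.constraints H.constraints_bar, Finset.mul_sum,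
    Real.exp_sum]
  refine Finset.prod_congr rfl fun M hM => ?_
  have h0 : M ≠ 0 := by
    rintro rfl
    have := braneInd_zero s
    simp [braneInd, hM] at this
  rw [H.entry_eq M ht, if_neg h0, one_mul]

/-- The harmonic gauge kills the term `∑ a K - 2 a 0` in the spatial components; in the `00`
component `sum_logScaleDeriv_sq` trades the squared velocities for the potential. -/
theorem ricci_eq (H : IsBraneSolution Q J q f c cbar) {x : Pt} (hx : x ∈ region J)
    (M N : Fin 11) :
    ricci (braneMetric f c cbar) x M N = if M = N then
      (braneMetricEntry f c cbar M (x 0) / braneMetricEntry f c cbar 0 (x 0)) *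
        ∑ s, ((braneInd s M + if M = 0 then 1 else 0) - 1 / 3) * (Q s ^ 2 * todaExp q s (x 0))
      else 0 := by
  have hS : ∑ M, logScaleDeriv q c M (x 0) = 2 * logScaleDeriv q c 0 (x 0) :=
    sum_braneInd_harmonic (fun s => deriv (q s) (x 0)) (sum_eq_two_mul_of_constraints H.constraints)
  have hS' : ∑ M, ∑ s, (1 / 3 - braneInd s M) * (Q s ^ 2 * todaExp q s (x 0)) =
      (2 / 3) * ∑ s, Q s ^ 2 * todaExp q s (x 0) := by
    rw [Finset.sum_comm, Finset.mul_sum]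
    refine Finset.sum_congr rfl fun s _ => ?_
    rw [← Finset.sum_mul, Finset.sum_sub_distrib, sum_braneInd, Finset.sum_const,
      Finset.card_univ, Fintype.card_fin, nsmul_eq_mul]
    push_cast
    ring
  have hq := sum_logScaleDeriv_sq H.constraints (H.energy _ hx)
  rw [braneMetric_eq, ricci_diagMetric H.isOpen (fun M t ht => H.entry_ne_zero M ht)
    (fun M t ht => H.hasDerivAt_entry M ht) hx (fun M => H.hasDerivAt_logScaleDeriv M hx), hS, hS']
  split_ifs with hMN hM
  · subst hM
    rw [div_self (H.entry_ne_zero 0 hx), one_mul]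
    simp only [braneInd_zero, Fin.sum_univ_four] at *
    linarith
  · simp only [Fin.sum_univ_four]
    ring
  · rfl

theorem scalarCurvature_eq (H : IsBraneSolution Q J q f c cbar) {x : Pt} (hx : x ∈ region J) :
    scalarCurvature (braneMetric f c cbar) x =
      (∑ s, Q s ^ 2 * todaExp q s (x 0)) / (3 * braneMetricEntry f c cbar 0 (x 0)) := by
  simp only [scalarCurvature, H.ricci_eq hx]
  simp only [braneMetric_eq, diagMetric_inv (fun M => H.entry_ne_zero M hx),
    Matrix.diagonal_apply, mul_ite, mul_zero, ite_mul, zero_mul, Finset.sum_ite_eq,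
    Finset.mem_univ, if_true]
  have h1 : ∀ M, (braneMetricEntry f c cbar M (x 0))⁻¹ *
      (braneMetricEntry f c cbar M (x 0) / braneMetricEntry f c cbar 0 (x 0) *
        ∑ s, ((braneInd s M + if M = 0 then 1 else 0) - 1 / 3) * (Q s ^ 2 * todaExp q s (x 0))) =
      (braneMetricEntry f c cbar 0 (x 0))⁻¹ *
        ∑ s, ((braneInd s M + if M = 0 then 1 else 0) - 1 / 3) * (Q s ^ 2 * todaExp q s (x 0)) := by
    intro M
    rw [← mul_assoc, inv_mul_eq_div, div_div_cancel_left' (H.entry_ne_zero M hx)]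
  simp only [h1]
  rw [← Finset.mul_sum, Finset.sum_comm]
  -- Each brane contributes `3 + 1 - 11/3 = 1/3` to the trace.
  simp only [← Finset.sum_mul, Finset.sum_sub_distrib, Finset.sum_add_distrib, sum_braneInd]
  simp only [Fin.sum_univ_four, Finset.sum_ite_eq', Finset.mem_univ, if_true, Finset.sum_const,
    Finset.card_univ, Fintype.card_fin, nsmul_eq_mul]
  have := H.entry_ne_zero 0 hx
  field_simp
  norm_num

theorem normSq_eq (H : IsBraneSolution Q J q f c cbar) {x : Pt} (hx : x ∈ region J) :
    normSq (braneMetric f c cbar) (braneForm Q f) x =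
      24 * (∑ s, Q s ^ 2 * todaExp q s (x 0)) / braneMetricEntry f c cbar 0 (x 0) := by
  rw [braneMetric_eq, braneForm_eq, normSq_coordSum (fun M => H.entry_ne_zero M hx)]
  simp only [comp_braneIndex, H.prod_entry_inv _ hx, H.coeff_eq _ hx]
  rw [mul_div_assoc, Finset.sum_div, show ((Nat.factorial 4 : ℕ) : ℝ) = 24 by
    norm_num [Nat.factorial]]
  congr 1
  refine Finset.sum_congr rfl fun s _ => ?_
  have h1 := H.entry_ne_zero 0 hx
  have h2 : todaExp q s (x 0) ≠ 0 := (Real.exp_pos _).ne'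
  field_simp

theorem contractPair_eq (H : IsBraneSolution Q J q f c cbar) {x : Pt} (hx : x ∈ region J)
    (M N : Fin 11) :
    contractPair (braneMetric f c cbar) (braneForm Q f) x M N = if M = N then
      6 * (braneMetricEntry f c cbar M (x 0) / braneMetricEntry f c cbar 0 (x 0)) *
        ∑ s, (braneInd s M + if M = 0 then 1 else 0) * (Q s ^ 2 * todaExp q s (x 0))
      else 0 := by
  rw [braneMetric_eq, braneForm_eq, contractPair_coordSum (fun M => H.entry_ne_zero M hx)]
  simp only [comp_cons_braneIndex, H.coeff_eq _ hx]
  have h1 : ∀ (s : Fin 4) (j : Fin 4),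
      (-1 : ℝ) ^ (j : ℕ) * (if M = braneIndex s j then 1 else 0) *
        ((∏ i, (braneMetricEntry f c cbar (braneIndex s (j.succAbove i)) (x 0))⁻¹) *
          (Q s * todaExp q s (x 0) *
            ((-1) ^ (j : ℕ) * if N = braneIndex s j then 1 else 0))) =
      if M = N then (if M = braneIndex s j then 1 else 0) *
        (Q s * (braneMetricEntry f c cbar M (x 0) / braneMetricEntry f c cbar 0 (x 0)))
      else 0 := by
    intro s j
    by_cases hM : M = braneIndex s j
    · by_cases hN : N = braneIndex s j
      · have h2 := Fin.prod_univ_succAbove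
          (fun j => (braneMetricEntry f c cbar (braneIndex s j) (x 0))⁻¹) j
        rw [H.prod_entry_inv s hx, ← hM] at h2
        have h3 := H.entry_ne_zero M hx
        have h4 := H.entry_ne_zero 0 hx
        have h5 : todaExp q s (x 0) ≠ 0 := (Real.exp_pos _).ne'
        have h6 : ((-1 : ℝ) ^ (j : ℕ)) * (-1) ^ (j : ℕ) = 1 := by
          rw [← mul_pow]; simp
        rw [if_pos hM, if_pos hN, if_pos (hM.trans hN.symm)]
        -- Omitting the free index from the full product of inverse entries leaves a factor of the
        -- entry `M` itself.
        have h7 : ∏ i, (braneMetricEntry f c cbar (braneIndex s (j.succAbove i)) (x 0))⁻¹ =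
            braneMetricEntry f c cbar M (x 0) *
              ((braneMetricEntry f c cbar 0 (x 0))⁻¹ * (todaExp q s (x 0))⁻¹) := by
          rw [h2, mul_inv_cancel_left₀ h3]
        rw [h7]
        calc _ = ((-1 : ℝ) ^ (j : ℕ) * (-1) ^ (j : ℕ)) * (Q s * (braneMetricEntry f c cbar M (x 0) /
              braneMetricEntry f c cbar 0 (x 0))) * (todaExp q s (x 0) * (todaExp q s (x 0))⁻¹) := by
              ring
          _ = _ := by rw [h6, mul_inv_cancel₀ h5]; ring
      · rw [if_neg hN, if_neg fun h : M = N => hN (h.symm.trans hM)]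
        simp
    · simp [hM]
  simp only [h1]
  by_cases hMN : M = N
  · simp only [if_pos hMN, ← Finset.sum_mul, sum_ite_braneIndex]
    rw [mul_assoc, Finset.mul_sum (a := _ / _)]
    congr 1
    exact Finset.sum_congr rfl fun s _ => by ring
  · simp [hMN]

theorem einstein (H : IsBraneSolution Q J q f c cbar) {x : Pt} (hx : x ∈ region J)
    (M N : Fin 11) :
    ricci (braneMetric f c cbar) x M N
        - (1 / 2) * scalarCurvature (braneMetric f c cbar) x * braneMetric f c cbar x M N =
      (1 / (Nat.factorial 4 : ℝ)) *
        (4 * contractPair (braneMetric f c cbar) (braneForm Q f) x M N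
          - (1 / 2) * braneMetric f c cbar x M N *
            normSq (braneMetric f c cbar) (braneForm Q f) x) := by
  rw [H.ricci_eq hx, H.scalarCurvature_eq hx, H.contractPair_eq hx, H.normSq_eq hx,
    show ((Nat.factorial 4 : ℕ) : ℝ) = 24 by norm_num [Nat.factorial], braneMetric_eq, diagMetric]
  by_cases hMN : M = N
  · subst hMN
    simp only [if_true, Matrix.diagonal_apply_eq]
    have h4 := H.entry_ne_zero 0 hx
    have h5 : ∑ s, ((braneInd s M + if M = 0 then 1 else 0) - 1 / 3) *
        (Q s ^ 2 * todaExp q s (x 0)) =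
        ∑ s, (braneInd s M + if M = 0 then 1 else 0) * (Q s ^ 2 * todaExp q s (x 0)) -
        (1 / 3) * ∑ s, Q s ^ 2 * todaExp q s (x 0) := by
      rw [Finset.mul_sum, ← Finset.sum_sub_distrib]
      exact Finset.sum_congr rfl fun s _ => by ring
    rw [h5]
    -- Both sides equal `(g_MM / g₀₀)(A - B/2)`.
    generalize ∑ s, (braneInd s M + if M = 0 then 1 else 0) * (Q s ^ 2 * todaExp q s (x 0)) = A
    generalize ∑ s, Q s ^ 2 * todaExp q s (x 0) = B
    field_simp
    ring
  · simp [hMN]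

/-- The gauge makes `√|g|` cancel the inverse time entry, and raising the brane indices cancels the
`todaExp` in the coefficient. Only constants remain, so the divergence vanishes. -/
theorem sqrt_abs_det_mul_raised (H : IsBraneSolution Q J q f c cbar) {x : Pt}
    (hx : x ∈ region J) (I : Fin 4 → Fin 11) :
    √|(braneMetric f c cbar x).det| * raised (braneMetric f c cbar) (braneForm Q f) x I =
      -∑ s, Q s * coordForm (braneIndex s) (fun j => basisVec (I j)) := by
  have hS : ∑ M, logScale q c cbar M (x 0) = 2 * logScale q c cbar 0 (x 0) := by
    refine sum_braneInd_harmonic (fun s => q s (x 0)) (c := fun M => c M * x 0 + cbar M) ?_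
    rw [Finset.sum_add_distrib, ← Finset.sum_mul, sum_eq_two_mul_of_constraints H.constraints,
      sum_eq_two_mul_of_constraints H.constraints_bar]
    ring
  have hdet : √|(braneMetric f c cbar x).det| = -braneMetricEntry f c cbar 0 (x 0) := by
    rw [braneMetric_eq, diagMetric, Matrix.det_diagonal, Finset.abs_prod]
    have h1 : ∀ M, |braneMetricEntry f c cbar M (x 0)| =
        Real.exp (2 * logScale q c cbar M (x 0)) := by
      intro M
      rw [H.entry_eq M hx, abs_mul, Real.abs_exp]
      split_ifs <;> simp
    simp only [h1]
    rw [← Real.exp_sum, ← Finset.mul_sum, hS, H.entry_eq 0 hx, two_mul (2 * _), Real.exp_add,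
      Real.sqrt_mul_self (Real.exp_pos _).le]
    simp
  rw [hdet, braneMetric_eq, braneForm_eq, raised_diagMetric (fun M => H.entry_ne_zero M hx),
    comp_coordSum, Finset.mul_sum, Finset.mul_sum, ← Finset.sum_neg_distrib]
  refine Finset.sum_congr rfl fun s _ => ?_
  rw [H.coeff_eq s hx]
  have h2 := coordForm_mul_prod (braneIndex s) I fun M => (braneMetricEntry f c cbar M (x 0))⁻¹
  rw [H.prod_entry_inv s hx] at h2
  rw [mul_left_comm (∏ j, _), h2]
  have h4 := H.entry_ne_zero 0 hx
  have h5 : todaExp q s (x 0) ≠ 0 := (Real.exp_pos _).ne'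
  field_simp

theorem pd_sqrt_abs_det_mul_raised (H : IsBraneSolution Q J q f c cbar) {x : Pt}
    (hx : x ∈ region J) (M : Fin 11) (I : Fin 4 → Fin 11) :
    pd M (fun y => √|(braneMetric f c cbar y).det| *
      raised (braneMetric f c cbar) (braneForm Q f) y I) x = 0 := by
  rw [pd_congr (f' := fun _ => -∑ s, Q s * coordForm (braneIndex s) (fun j => basisVec (I j)))]
  · simp [pd]
  · filter_upwards [(isOpen_region H.isOpen).mem_nhds hx] with y hy
      using H.sqrt_abs_det_mul_raised hy I

theorem lorentzian (H : IsBraneSolution Q J q f c cbar) {x : Pt} (hx : x ∈ region J) :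
    HasLorentzSignature (n := 10) (braneMetric f c cbar x) := by
  refine ⟨Matrix.diagonal fun M => Real.exp (-logScale q c cbar M (x 0)), ?_, ?_⟩
  · rw [Matrix.det_diagonal, ← Real.exp_sum]
    exact (Real.exp_pos _).ne'.isUnit
  · rw [Matrix.diagonal_transpose, braneMetric_eq, diagMetric, Matrix.diagonal_mul_diagonal,
      Matrix.diagonal_mul_diagonal]
    congr 1
    ext M
    have h1 : Real.exp (-logScale q c cbar M (x 0)) * braneMetricEntry f c cbar M (x 0) *
        Real.exp (-logScale q c cbar M (x 0)) = if M = 0 then -1 else 1 := by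
      rw [H.entry_eq M hx, two_mul, Real.exp_add, Real.exp_neg]
      have := (Real.exp_pos (logScale q c cbar M (x 0))).ne'
      field_simp
    rw [h1]
    refine Fin.cases ?_ (fun i => ?_) M <;> simp

/-- The Toda equation reads `Q_s todaExp = d/dt (-q̇^s / (2 Q_s))`, which supplies the potential. -/
theorem exists_potential (H : IsBraneSolution Q J q f c cbar) :
    ∃ A : FormField 3, ContDiffOn ℝ ∞ A (region J) ∧
      ∀ x ∈ region J, extDeriv A x = braneForm Q f x := by
  refine ⟨coordSum (fun s y => (fun t => -(1 / (2 * Q s)) * deriv (q s) t) (y 0))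
    fun s j => braneIndex s j.succ, contDiffOn_coordSum (fun s => contDiffOn_time
      (contDiffOn_const.mul (H.toda.contDiffOn_deriv H.isOpen s))) _, fun x hx => ?_⟩
  rw [extDeriv_coordSum_time fun s => (H.toda s _ hx).2.const_mul _]
  simp only [cons_zero_braneIndex, braneForm_eq, coordSum, H.coeff_eq _ hx]
  refine Finset.sum_congr rfl fun s _ => ?_
  congr 1
  have := H.charge_ne_zero s
  field_simp

theorem solvesFieldEquations (H : IsBraneSolution Q J q f c cbar) (k : ℝ) :
    SolvesFieldEquations k (region J) (braneMetric f c cbar) (braneForm Q f) where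
  smooth_metric M N := by
    by_cases hMN : M = N
    · subst hMN
      simp only [braneMetric_eq, diagMetric, Matrix.diagonal_apply_eq]
      exact contDiffOn_time (H.contDiffOn_entry M)
    · simp only [braneMetric_eq, diagMetric, Matrix.diagonal_apply_ne _ hMN]
      exact contDiffOn_const
  lorentzian x hx := H.lorentzian hx
  smooth_form := contDiffOn_coordSum (fun s => contDiffOn_time
    ((contDiffOn_const.mul (contDiffOn_todaExp (fun s => H.toda.contDiffOn H.isOpen s) s)).congr
      fun t ht => H.coeff_eq s ht)) _
  exists_potential := H.exists_potential
  einstein x hx M N := H.einstein hx M N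
  form_equation x hx N P R := by
    simp only [H.pd_sqrt_abs_det_mul_raised hx, wedgeSelf_braneForm]
    simp

end IsBraneSolution

/-! ### The special one-block solution -/

/-- Here `g` is the derivative of `fBar`. The second-order equation and its first integral are all
that is used later, so the three signs of `C` are treated uniformly from here on. -/
theorem exists_hasDerivAt_fBar (Q C t₀ : ℝ) :
    ∃ g : ℝ → ℝ, (∀ t, HasDerivAt (fBar Q C t₀) (g t) t) ∧
      (∀ t, HasDerivAt g (C * fBar Q C t₀ t) t) ∧
      ∀ t, g t ^ 2 - C * fBar Q C t₀ t ^ 2 = 2 * Q ^ 2 := by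
  have hlin : ∀ w t : ℝ, HasDerivAt (fun t => w * (t - t₀)) w t := fun w t => by
    simpa using ((hasDerivAt_id t).sub_const t₀).const_mul w
  rcases lt_trichotomy C 0 with hC | hC | hC
  · have hf : fBar Q C t₀ = fun t => |Q| * √(2 / |C|) * Real.sin (√|C| * (t - t₀)) := by
      ext t; rw [fBar, if_neg hC.not_gt, if_pos hC]
    have hw : √|C| ^ 2 = -C := by rw [Real.sq_sqrt (abs_nonneg C), abs_of_neg hC]
    have hk : (|Q| * √(2 / |C|)) ^ 2 * √|C| ^ 2 = 2 * Q ^ 2 := by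
      have : |C| ≠ 0 := abs_ne_zero.2 hC.ne
      rw [mul_pow, sq_abs, Real.sq_sqrt (by positivity), Real.sq_sqrt (abs_nonneg C)]
      field_simp
    rw [hf]
    generalize |Q| * √(2 / |C|) = k at *
    generalize √|C| = w at *
    refine ⟨fun t => k * w * Real.cos (w * (t - t₀)), fun t => ?_, fun t => ?_, fun t => ?_⟩
    · exact ((hlin w t).sin.const_mul k).congr_deriv (by ring)
    · refine ((hlin w t).cos.const_mul (k * w)).congr_deriv ?_
      linear_combination -(k * Real.sin (w * (t - t₀))) * hw
    · have h := Real.sin_sq_add_cos_sq (w * (t - t₀))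
      linear_combination hk + k ^ 2 * w ^ 2 * h - k ^ 2 * Real.sin (w * (t - t₀)) ^ 2 * hw
  · subst hC
    have hf : fBar Q 0 t₀ = fun t => |Q| * √2 * (t - t₀) := by
      ext t; simp [fBar]
    rw [hf]
    refine ⟨fun t => |Q| * √2, hlin _, fun t => ?_, fun t => ?_⟩
    · simpa using hasDerivAt_const t (|Q| * √2)
    · rw [mul_pow, sq_abs, Real.sq_sqrt (by norm_num)]
      ring
  · have hf : fBar Q C t₀ = fun t => |Q| * √(2 / C) * Real.sinh (√C * (t - t₀)) := by
      ext t; rw [fBar, if_pos hC]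
    have hw : √C ^ 2 = C := Real.sq_sqrt hC.le
    have hk : (|Q| * √(2 / C)) ^ 2 * √C ^ 2 = 2 * Q ^ 2 := by
      rw [mul_pow, sq_abs, Real.sq_sqrt (by positivity), hw]
      field_simp
    rw [hf]
    generalize |Q| * √(2 / C) = k at *
    generalize √C = w at *
    refine ⟨fun t => k * w * Real.cosh (w * (t - t₀)), fun t => ?_, fun t => ?_, fun t => ?_⟩
    · exact ((hlin w t).sinh.const_mul k).congr_deriv (by ring)
    · refine ((hlin w t).cosh.const_mul (k * w)).congr_deriv ?_
      linear_combination (k * Real.sinh (w * (t - t₀))) * hw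
    · have h := Real.cosh_sq_sub_sinh_sq (w * (t - t₀))
      linear_combination hk + k ^ 2 * w ^ 2 * h + k ^ 2 * Real.sinh (w * (t - t₀)) ^ 2 * hw

theorem bCoeff_even (s : Fin 4) : Even (bCoeff s) := by
  revert s; decide

theorem bCoeff_neg (s : Fin 4) : bCoeff s < 0 := by
  revert s; decide

theorem sum_cartanR_mul_bCoeff (s : Fin 4) : ∑ s', cartanR s s' * (bCoeff s' : ℝ) = 2 := by
  have h : ∀ s : Fin 4, ∑ s', cartan s s' * bCoeff s' = 2 := by decide
  simp only [cartanR, Matrix.map_apply]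
  exact_mod_cast h s

theorem sum_bCoeff : ∑ s, (bCoeff s : ℝ) = -44 := by
  have h : ∑ s, bCoeff s = -44 := by decide
  exact_mod_cast h

section Special

variable {F g : ℝ → ℝ} {Q₀ C : ℝ} {Q : Fin 4 → ℝ} {J : Set ℝ}

/-- Since `A b = (2,2,2,2)`, all four exponentials coincide and the chain collapses to one equation.
-/
theorem todaExp_special {t : ℝ} (hF : F t ≠ 0) (s : Fin 4) :
    todaExp (fun s t => -Real.log (F t ^ bCoeff s)) s t = (F t ^ 2)⁻¹ := by
  have h : ∑ s', cartanR s s' * -Real.log (F t ^ bCoeff s') = -Real.log (F t ^ 2) := by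
    have h1 : ∀ s', cartanR s s' * -Real.log (F t ^ bCoeff s') =
        (cartanR s s' * (bCoeff s' : ℝ)) * -Real.log (F t) := fun s' => by
      rw [Real.log_zpow]; ring
    simp only [h1]
    rw [← Finset.sum_mul, sum_cartanR_mul_bCoeff, Real.log_pow]
    push_cast
    ring
  rw [todaExp, h, Real.exp_neg, Real.exp_log (by positivity)]

theorem hasDerivAt_special {t : ℝ} (hF : F t ≠ 0) (hd : HasDerivAt F (g t) t) (s : Fin 4) :
    HasDerivAt (fun t => -Real.log (F t ^ bCoeff s)) (-bCoeff s * (g t / F t)) t := by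
  simp only [Real.log_zpow]
  exact ((hd.log hF).const_mul (bCoeff s : ℝ)).neg.congr_deriv (by ring)

/-- Here `q̈^s = -b_s (C F² - g²)/F² = 2 b_s Q₀²/F²`, and `b_s = -|b_s|`. -/
theorem isTodaSolution_special (hJ : IsOpen J) (hF : ∀ t ∈ J, F t ≠ 0)
    (hd : ∀ t, HasDerivAt F (g t) t) (hg : ∀ t, HasDerivAt g (C * F t) t)
    (hC : ∀ t, g t ^ 2 - C * F t ^ 2 = 2 * Q₀ ^ 2)
    (hQ : ∀ s, Q s ^ 2 = Q₀ ^ 2 * |(bCoeff s : ℝ)|) :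
    IsTodaSolution Q J (fun s t => -Real.log (F t ^ bCoeff s)) := by
  intro s t ht
  refine ⟨(hasDerivAt_special (hF t ht) (hd t) s).differentiableAt, ?_⟩
  have h1 : deriv (fun t => -Real.log (F t ^ bCoeff s)) =ᶠ[𝓝 t]
      fun t => -bCoeff s * (g t / F t) := by
    filter_upwards [hJ.mem_nhds ht] with u hu
    exact (hasDerivAt_special (hF u hu) (hd u) s).deriv
  refine ((((hg t).div (hd t) (hF t ht)).const_mul (-(bCoeff s : ℝ))).congr_of_eventuallyEq
    h1).congr_deriv ?_
  have hb : |(bCoeff s : ℝ)| = -bCoeff s := abs_of_neg (by exact_mod_cast bCoeff_neg s)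
  have h0 := hF t ht
  rw [todaExp_special h0, hQ, hb]
  field_simp
  linear_combination (bCoeff s : ℝ) * hC t

/-- As `∑ b_s = -44` and `∑ A b b = -88`, the energy is `(-11 g² + 22 Q₀²)/F²`, and the first
integral applies. -/
theorem todaEnergy_special {t : ℝ} (hF : F t ≠ 0)
    (hd : HasDerivAt F (g t) t) (hC : g t ^ 2 - C * F t ^ 2 = 2 * Q₀ ^ 2)
    (hQ : ∀ s, Q s ^ 2 = Q₀ ^ 2 * |(bCoeff s : ℝ)|) :
    todaEnergy Q (fun s t => -Real.log (F t ^ bCoeff s)) t = -11 * C := by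
  have hb : ∀ s, |(bCoeff s : ℝ)| = -bCoeff s := fun s =>
    abs_of_neg (by exact_mod_cast bCoeff_neg s)
  have h1 : ∑ s, ∑ s', cartanR s s' * (-(bCoeff s : ℝ) * (g t / F t)) *
      (-(bCoeff s' : ℝ) * (g t / F t)) = -88 * (g t / F t) ^ 2 := by
    have h2 : ∀ s s', cartanR s s' * (-(bCoeff s : ℝ) * (g t / F t)) *
        (-(bCoeff s' : ℝ) * (g t / F t)) =
        ((bCoeff s : ℝ) * (g t / F t) ^ 2) * (cartanR s s' * (bCoeff s' : ℝ)) := fun s s' => by ring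
    simp only [h2, ← Finset.mul_sum, sum_cartanR_mul_bCoeff]
    rw [← Finset.sum_mul, ← Finset.sum_mul, sum_bCoeff]
    ring
  have h3 : ∑ s, Q s ^ 2 * (F t ^ 2)⁻¹ = 44 * Q₀ ^ 2 * (F t ^ 2)⁻¹ := by
    simp only [hQ, hb]
    rw [← Finset.sum_mul, ← Finset.mul_sum, Finset.sum_neg_distrib, sum_bCoeff]
    ring
  simp only [todaEnergy, todaExp_special hF, (hasDerivAt_special hF hd _).deriv]
  rw [h1, h3]
  field_simp
  linear_combination -176 * hC

end Special

end SBrane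

theorem mainTheorem4 :
    -- the four brane sets obey the intersection rules of the hyperbolic algebra
    (SBrane.IsHyperbolicCartan (n := 3) SBrane.cartan ∧
      (∀ s, SBrane.scalarProd (SBrane.braneVec s) (SBrane.braneVec s) = 2) ∧
      (∀ s s', SBrane.cartanR s s' =
        2 * SBrane.scalarProd (SBrane.braneVec s) (SBrane.braneVec s') /
          SBrane.scalarProd (SBrane.braneVec s') (SBrane.braneVec s')) ∧
      (∀ s s', s ≠ s' →
        ((SBrane.braneSet s ∩ SBrane.braneSet s').card : ℝ) =
          ((SBrane.braneSet s).card : ℝ) * ((SBrane.braneSet s').card : ℝ) / (11 - 2)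
            + SBrane.cartanR s s')) ∧
    -- solutions governed by the Toda chain
    (∀ (J : Set ℝ), IsOpen J → J.OrdConnected →
      ∀ (Q : Fin 4 → ℝ), (∀ s, Q s ≠ 0) →
      ∀ (q : Fin 4 → ℝ → ℝ), SBrane.IsTodaSolution Q J q →
        (∃ E : ℝ, ∀ t ∈ J, SBrane.todaEnergy Q q t = E) ∧
        ∀ (E : ℝ), (∀ t ∈ J, SBrane.todaEnergy Q q t = E) →
        ∀ (c cbar : Fin 11 → ℝ), SBrane.BraneConstraints c → SBrane.BraneConstraints cbar →
          SBrane.EnergyConstraint E c →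
          SBrane.SolvesB11 (SBrane.region J)
            (SBrane.braneMetric (fun s t => Real.exp (-q s t)) c cbar)
            (SBrane.braneForm Q (fun s t => Real.exp (-q s t))) ∧
          (∀ x ∈ SBrane.region J, ∀ v : Fin 8 → SBrane.Pt,
            SBrane.wedgeSelf (SBrane.braneForm Q (fun s t => Real.exp (-q s t))) x v = 0) ∧
          ∀ σ : ℤˣ, SBrane.SolvesSupergravity σ (SBrane.region J)
            (SBrane.braneMetric (fun s t => Real.exp (-q s t)) c cbar)
            (SBrane.braneForm Q (fun s t => Real.exp (-q s t)))) ∧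
    -- the special one-block solution
    ((∀ s, 2 * ∑ s', SBrane.cartanR⁻¹ s s' = (SBrane.bCoeff s : ℝ)) ∧
      ∀ (Q₀ C t₀ : ℝ), Q₀ ≠ 0 →
      ∀ (Q : Fin 4 → ℝ), (∀ s, Q s ^ 2 = Q₀ ^ 2 * |(SBrane.bCoeff s : ℝ)|) →
      ∀ (J : Set ℝ), IsOpen J → J.OrdConnected → (∀ t ∈ J, SBrane.fBar Q₀ C t₀ t ≠ 0) →
      ∀ (f : Fin 4 → ℝ → ℝ), (f = fun s t => SBrane.fBar Q₀ C t₀ t ^ SBrane.bCoeff s) →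
        (∀ s, ∀ t ∈ J, 0 < f s t) ∧
        SBrane.IsTodaSolution Q J (fun s t => -Real.log (f s t)) ∧
        (∀ t ∈ J, SBrane.todaEnergy Q (fun s t => -Real.log (f s t)) t = -11 * C) ∧
        ∀ (c cbar : Fin 11 → ℝ), SBrane.BraneConstraints c → SBrane.BraneConstraints cbar →
          SBrane.EnergyConstraint (-11 * C) c →
          SBrane.SolvesB11 (SBrane.region J)
            (SBrane.braneMetric f c cbar) (SBrane.braneForm Q f) ∧
          ∀ σ : ℤˣ, SBrane.SolvesSupergravity σ (SBrane.region J)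
            (SBrane.braneMetric f c cbar) (SBrane.braneForm Q f)) := by
  refine ⟨⟨SBrane.cartan_isHyperbolicCartan, fun s => ?_, fun s s' => ?_, fun s s' _ => ?_⟩,
    fun J hJ hJc Q hQ q hq => ⟨hq.exists_todaEnergy_eq hJ hJc, fun E hE c cbar hc hcbar hEc => ?_⟩,
    SBrane.two_mul_sum_cartanR_inv,
    fun Q₀ C t₀ hQ₀ Q hQ J hJ _ hF f hf => ?_⟩
  · rw [SBrane.scalarProd_braneVec, SBrane.cartanR_diag]
  · rw [SBrane.scalarProd_braneVec, SBrane.scalarProd_braneVec, SBrane.cartanR_diag]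
    ring
  · rw [SBrane.card_braneSet_inter, SBrane.card_braneSet, SBrane.card_braneSet]
    norm_num
  · have H : SBrane.IsBraneSolution Q J q (fun s t => Real.exp (-q s t)) c cbar :=
      ⟨hJ, hQ, hq, fun _ _ _ => rfl, hc, hcbar, fun t ht => (hE t ht).symm ▸ hEc⟩
    exact ⟨H.solvesFieldEquations 0, fun x _ v => SBrane.wedgeSelf_braneForm Q _ x v,
      fun σ => H.solvesFieldEquations _⟩
  · subst hf
    obtain ⟨g, hd, hg, hC⟩ := SBrane.exists_hasDerivAt_fBar Q₀ C t₀
    -- All `b_s` are even, so the sign of `fBar` on `J` does not matter.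
    have hpos : ∀ s, ∀ t ∈ J, 0 < SBrane.fBar Q₀ C t₀ t ^ SBrane.bCoeff s := fun s t ht =>
      (SBrane.bCoeff_even s).zpow_pos (hF t ht)
    have hq := SBrane.isTodaSolution_special hJ hF hd hg hC hQ
    have hE : ∀ t ∈ J, SBrane.todaEnergy Q
        (fun s t => -Real.log (SBrane.fBar Q₀ C t₀ t ^ SBrane.bCoeff s)) t = -11 * C :=
      fun t ht => SBrane.todaEnergy_special (hF t ht) (hd t) (hC t) hQ
    refine ⟨hpos, hq, hE, fun c cbar hc hcbar hEc => ?_⟩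
    have hQ0 : ∀ s, Q s ≠ 0 := fun s h => by
      have h1 := hQ s
      have h2 : (SBrane.bCoeff s : ℝ) ≠ 0 := by exact_mod_cast (SBrane.bCoeff_neg s).ne
      rw [h, zero_pow two_ne_zero] at h1
      exact mul_ne_zero (pow_ne_zero 2 hQ₀) (abs_ne_zero.2 h2) h1.symm
    have H : SBrane.IsBraneSolution Q J
        (fun s t => -Real.log (SBrane.fBar Q₀ C t₀ t ^ SBrane.bCoeff s))
        (fun s t => SBrane.fBar Q₀ C t₀ t ^ SBrane.bCoeff s) c cbar :=
      ⟨hJ, hQ0, hq, fun s t ht => by rw [neg_neg, Real.exp_log (hpos s t ht)], hc, hcbar,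
        fun t ht => (hE t ht).symm ▸ hEc⟩
    exact ⟨H.solvesFieldEquations 0, fun σ => H.solvesFieldEquations _⟩
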